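/- Let $G$ be a locally compact (Hausdorff) Abelian group, written additively. Notation. $\mathcal C(G)$ is the space of continuous complex valued functions on $G$ with the topology of uniform convergence on compact sets. A variety is a closed translation invariant linear subspace of $\mathcal C(G)$; a variety $V$ is synthesizable if the finite dimensional varieties contained in $V$ together span a dense subspace of $V$. $\mathcal M_c(G)$ is the space of compactly supported regular complex Borel measures on $G$ with the weak* topology, i.e. the coarsest topology for which $\mu\mapsto\int f\,d\mu$ is continuous for each $f$ in $\mathcal C(G)$, and $(\mu*f)(x)=\int f(x-y)\,d\mu(y)$. An exponential is a continuous homomorphism $m:G\to\mathbb C^{\times}$; the Fourier–Laplace transform of $\mu$ in $\mathcal M_c(G)$ is the function $\widehat\mu(m)=\int m(-x)\,d\mu(x)$ on the set of exponentials. The Fourier algebra $\mathcal A(G)=\{\widehat\mu:\mu\in\mathcal M_c(G)\}$ is an algebra under the pointwise operations; it is equipped with the topology carried over from the weak* topology of $\mathcal M_c(G)$ by $\mu\mapsto\widehat\mu$. A derivation of order $1$ is a nonzero continuous linear operator $D:\mathcal A(G)\to\mathcal A(G)$ with $D(ab)=D(a)b+aD(b)$ for all $a,b$. The elements of the algebra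 of operators generated by the identity and all derivations of order $1$ are called polynomial derivations. Let $\widehat I$ be a closed ideal of $\mathcal A(G)$, let $I=\{\mu\in\mathcal M_c(G):\widehat\mu\in\widehat I\}$, and let $\mathrm{Ann}\,I=\{f\in\mathcal C(G):\mu*f=0\text{ for all }\mu\in I\}$, which is a variety. A root of $\widehat I$ is an exponential $m$ with $\varphi(m)=0$ for all $\varphi\in\widehat I$. For a root $m$, let $\mathcal P_{\widehat I,m}$ be the set of polynomial derivations $D$ with $D(\varphi)(m)=0$ for all $\varphi\in\widehat I$. The ideal $\widehat I$ is localizable if every $\psi\in\mathcal A(G)$ that satisfies $D(\psi)(m)=0$ for every root $m$ of $\widehat I$ and every $D\in\mathcal P_{\widehat I,m}$ belongs to $\widehat I$. Theorem. $\mathrm{Ann}\,I$ is synthesizable if and only if $\widehat I$ is localizable. -/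

import Mathlib

open MeasureTheory Topology
open scoped Pointwise

noncomputable section

namespace SpectralSynthesis

/-! ## Compactly supported complex measures and their integrals -/

/-- The integral `∫ f dμ` of a complex function against a complex measure. -/
def pairing {G : Type*} [MeasurableSpace G] (μ : ComplexMeasure G) (f : G → ℂ) : ℂ :=
  VectorMeasure.integral μ f (ContinuousLinearMap.mul ℝ ℂ)

/-- `μ` is a regular complex Borel measure with compact support: its total variation is a regular
measure that vanishes outside a compact set. -/
structure IsCompactRadon {G : Type*} [TopologicalSpace G] [MeasurableSpace G]
    (μ : ComplexMeasure G) : Prop where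
  regular : μ.variation.Regular
  compact : ∃ K : Set G, IsCompact K ∧ μ.variation Kᶜ = 0

section Measures

variable {G : Type*} [MeasurableSpace G]

theorem setToFun_mul_left {ρ : Measure G} {T T' : Set G → ℂ →L[ℝ] ℂ} {C C' : ℝ}
    (hT : DominatedFinMeasAdditive ρ T C) (hT' : DominatedFinMeasAdditive ρ T' C') (c : ℂ)
    (h : ∀ s, MeasurableSet s → ∀ x, T' s x = c * T s x) {f : G → ℂ} (hf : Integrable f ρ) :
    setToFun ρ T' hT' f = c * setToFun ρ T hT f := by
  refine Integrable.induction (fun f : G → ℂ => setToFun ρ T' hT' f = c * setToFun ρ T hT f)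
    ?_ ?_ ?_ ?_ hf
  · intro x s hs hlt
    rw [setToFun_indicator_const hT hs hlt.ne, setToFun_indicator_const hT' hs hlt.ne, h s hs]
  · intro f g _ hf hg h1 h2
    rw [setToFun_add _ hf hg, setToFun_add _ hf hg, h1, h2, mul_add]
  · exact isClosed_eq (continuous_setToFun hT') (continuous_const.mul (continuous_setToFun hT))
  · intro f g hfg _ h1
    rw [← setToFun_congr_ae hT hfg, ← setToFun_congr_ae hT' hfg, h1]

theorem pairing_smul {μ : ComplexMeasure G} (c : ℂ) {f : G → ℂ}
    (hf : Integrable f μ.variation) :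
    pairing (c • μ) f = c * pairing μ f := by
  have hv : (c • μ).variation ≤ (‖c‖₊ : ENNReal) • μ.variation :=
    le_of_eq VectorMeasure.variation_smul
  have hT := dominatedFinMeasAdditive_cbmApplyMeasure μ (ContinuousLinearMap.mul ℝ ℂ)
  have hT' := (dominatedFinMeasAdditive_cbmApplyMeasure (c • μ)
    (ContinuousLinearMap.mul ℝ ℂ)).of_measure_le_smul (by simp) hv
      (ContinuousLinearMap.opNorm_nonneg _)
  have key := setToFun_mul_left hT hT' c
    (fun s hs x => by
      rw [transpose_eq_cbmApplyMeasure, cbmApplyMeasure_apply, transpose_eq_cbmApplyMeasure,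
        cbmApplyMeasure_apply, smul_apply, ContinuousLinearMap.mul_apply',
        ContinuousLinearMap.mul_apply', smul_eq_mul]
      ring) hf
  unfold pairing
  rw [VectorMeasure.integral_eq_setToFun, VectorMeasure.integral_eq_setToFun, ← key]
  symm
  exact setToFun_congr_measure_of_integrable _ (by simp) hv _ _ _ hf

theorem toComplexMeasure_apply (ρ : Measure G) [IsFiniteMeasure ρ] {s : Set G}
    (hs : MeasurableSet s) :
    (ρ.toSignedMeasure.toComplexMeasure 0) s = ((ρ.real s : ℝ) : ℂ) := by
  simp [hs, SignedMeasure.toComplexMeasure_apply]; rfl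

theorem variation_toComplexMeasure_le (ρ : Measure G) [IsFiniteMeasure ρ] :
    (ρ.toSignedMeasure.toComplexMeasure 0).variation ≤ ρ := by
  apply VectorMeasure.variation_le_of_forall_enorm_le (fun s hs ↦ ?_)
  rw [toComplexMeasure_apply ρ hs, ← ofReal_norm, Complex.norm_real, ofReal_norm]
  simp [Measure.real, Real.enorm_eq_ofReal]

theorem pairing_of_measure (ρ : Measure G) [IsFiniteMeasure ρ] {f : G → ℂ} (hf : Integrable f ρ) :
    pairing (ρ.toSignedMeasure.toComplexMeasure 0) f = ∫ x, f x ∂ρ := by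
  rw [integral_eq_setToFun, pairing, VectorMeasure.integral_eq_setToFun]
  have hle := variation_toComplexMeasure_le ρ
  have hT := (dominatedFinMeasAdditive_cbmApplyMeasure (ρ.toSignedMeasure.toComplexMeasure 0)
    (ContinuousLinearMap.mul ℝ ℂ)).of_measure_le hle (ContinuousLinearMap.opNorm_nonneg _)
  rw [← setToFun_congr_measure_of_integrable 1 (by simp) (by simpa using hle) hT _ f hf]
  apply setToFun_congr_left' _ _ (fun s hs h's ↦ ?_)
  ext1
  rw [transpose_eq_cbmApplyMeasure, cbmApplyMeasure_apply, toComplexMeasure_apply ρ hs,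
    ContinuousLinearMap.mul_apply', weightedSMul_apply]
  simp [mul_comm]

theorem eq_comb_of_measures (μ : ComplexMeasure G) [IsFiniteMeasure μ.variation] :
    ∃ ρ : Fin 4 → Measure G, ∃ _ : ∀ i, IsFiniteMeasure (ρ i), (∀ i, ρ i ≤ μ.variation) ∧
      ∃ c : Fin 4 → ℂ, μ = ∑ i, c i • (ρ i).toSignedMeasure.toComplexMeasure 0 := by
  have hle : ∀ s : SignedMeasure G, s.variation ≤ μ.variation →
      s.toJordanDecomposition.posPart ≤ μ.variation ∧
      s.toJordanDecomposition.negPart ≤ μ.variation := by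
    intro s hs
    rw [← SignedMeasure.totalVariation_eq_variation] at hs
    exact ⟨le_trans (Measure.le_add_right le_rfl) hs, le_trans (Measure.le_add_left le_rfl) hs⟩
  have hre : (ComplexMeasure.re μ).variation ≤ μ.variation := by
    refine VectorMeasure.variation_le_of_forall_enorm_le fun s _ => ?_
    refine le_trans ?_ (VectorMeasure.enorm_measure_le_variation μ s)
    rw [← ofReal_norm, ← ofReal_norm]
    exact ENNReal.ofReal_le_ofReal (Complex.abs_re_le_norm _)
  have him : (ComplexMeasure.im μ).variation ≤ μ.variation := by
    refine VectorMeasure.variation_le_of_forall_enorm_le fun s _ => ?_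
    refine le_trans ?_ (VectorMeasure.enorm_measure_le_variation μ s)
    rw [← ofReal_norm, ← ofReal_norm]
    exact ENNReal.ofReal_le_ofReal (Complex.abs_im_le_norm _)
  set p := (ComplexMeasure.re μ).toJordanDecomposition with hp
  set q := (ComplexMeasure.im μ).toJordanDecomposition with hq
  have hfin : ∀ i, IsFiniteMeasure (![p.posPart, p.negPart, q.posPart, q.negPart] i) := by
    intro i; fin_cases i <;> simp <;> infer_instance
  refine ⟨![p.posPart, p.negPart, q.posPart, q.negPart], hfin, ?_,
    ![1, -1, Complex.I, -Complex.I], ?_⟩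
  · intro i
    fin_cases i
    exacts [(hle _ hre).1, (hle _ hre).2, (hle _ him).1, (hle _ him).2]
  · have h1 : ComplexMeasure.re μ = p.posPart.toSignedMeasure - p.negPart.toSignedMeasure :=
      ((ComplexMeasure.re μ).toSignedMeasure_toJordanDecomposition).symm
    have h2 : ComplexMeasure.im μ = q.posPart.toSignedMeasure - q.negPart.toSignedMeasure :=
      ((ComplexMeasure.im μ).toSignedMeasure_toJordanDecomposition).symm
    ext s hs
    have h3 : (μ s).re = p.posPart.real s - p.negPart.real s := by
      change ComplexMeasure.re μ s = _
      rw [h1]; simp [hs]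
    have h4 : (μ s).im = q.posPart.real s - q.negPart.real s := by
      change ComplexMeasure.im μ s = _
      rw [h2]; simp [hs]
    have h5 := fun i => @toComplexMeasure_apply G _ _ (hfin i) s hs
    rw [Fin.sum_univ_four]
    simp only [add_apply, smul_apply, h5]
    apply Complex.ext
    · simp [h3, sub_eq_add_neg]
    · simp [h4, sub_eq_add_neg]

theorem pairing_smul_right (μ : ComplexMeasure G) (c : ℂ) (f : G → ℂ) :
    pairing μ (fun x => c * f x) = c * pairing μ f := by
  refine setToFun_smul (𝕜 := ℂ) _ (fun c s x => ?_) c f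
  rw [transpose_eq_cbmApplyMeasure, cbmApplyMeasure_apply, cbmApplyMeasure_apply,
    ContinuousLinearMap.mul_apply', ContinuousLinearMap.mul_apply', smul_eq_mul, smul_eq_mul,
    mul_assoc]

variable [TopologicalSpace G]

theorem IsCompactRadon.isFinite {μ : ComplexMeasure G} (h : IsCompactRadon μ) :
    IsFiniteMeasure μ.variation := by
  obtain ⟨K, hK, h0⟩ := h.compact
  have := h.regular
  constructor
  calc μ.variation Set.univ ≤ μ.variation (K ∪ Kᶜ) := by simp
    _ ≤ μ.variation K + μ.variation Kᶜ := measure_union_le _ _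
    _ < ⊤ := by rw [h0, add_zero]; exact hK.measure_lt_top

theorem IsCompactRadon.smul {μ : ComplexMeasure G} (c : ℂ)
    (hμ : IsCompactRadon μ) : IsCompactRadon (c • μ) := by
  have := hμ.regular
  obtain ⟨K, hK, h0⟩ := hμ.compact
  refine ⟨?_, K, hK, ?_⟩
  · rw [VectorMeasure.variation_smul]; infer_instance
  · rw [VectorMeasure.variation_smul]; simp [h0]

theorem IsCompactRadon.zero : IsCompactRadon (0 : ComplexMeasure G) := by
  refine ⟨?_, ∅, isCompact_empty, ?_⟩
  · rw [VectorMeasure.variation_zero]; infer_instance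
  · simp

variable [T2Space G] [BorelSpace G]

theorem regular_of_le {ρ σ : Measure G} [IsFiniteMeasure ρ] [ρ.Regular] (hle : σ ≤ ρ) :
    σ.Regular := by
  have hf : IsFiniteMeasure σ := isFiniteMeasure_of_le _ hle
  have : σ.InnerRegularCompactLTTop := by
    constructor
    rintro A ⟨hA, -⟩ r hr
    obtain ⟨C, hCA, hC, hlt⟩ := hA.exists_isCompact_lt_add (μ := ρ) (measure_ne_top _ _)
      (tsub_pos_of_lt hr).ne'
    refine ⟨C, hCA, hC, ?_⟩
    have h1 : ρ (A \ C) < σ A - r := by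
      rw [measure_sdiff hCA hC.measurableSet.nullMeasurableSet (measure_ne_top _ _)]
      exact ENNReal.sub_lt_of_lt_add (measure_mono hCA) (by rwa [add_comm])
    have h2 : σ A ≤ σ C + σ (A \ C) := by
      rw [← measure_union Set.disjoint_sdiff_right (hA.diff hC.measurableSet)]
      exact measure_mono (by simp)
    have h3 : σ (A \ C) < σ A - r := (hle _).trans_lt h1
    by_contra! hcon
    have h4 : r + (σ A - r) = σ A := add_tsub_cancel_of_le hr.le
    have h5 : σ C + σ (A \ C) < r + (σ A - r) :=
      ENNReal.add_lt_add_of_le_of_lt (measure_ne_top _ _) hcon h3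
    rw [h4] at h5
    exact absurd h2 (not_le.mpr h5)
  infer_instance

theorem IsCompactRadon.of_le {μ : ComplexMeasure G}
    {ρ : Measure G} [IsFiniteMeasure ρ] [ρ.Regular] (hle : μ.variation ≤ ρ)
    {K : Set G} (hK : IsCompact K) (h0 : ρ Kᶜ = 0) : IsCompactRadon μ :=
  ⟨regular_of_le hle, K, hK, le_antisymm ((hle _).trans h0.le) bot_le⟩

theorem IsCompactRadon.add {μ ν : ComplexMeasure G}
    (hμ : IsCompactRadon μ) (hν : IsCompactRadon ν) : IsCompactRadon (μ + ν) := by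
  have := hμ.regular
  have := hν.regular
  have := hμ.isFinite
  have := hν.isFinite
  obtain ⟨K, hK, h0⟩ := hμ.compact
  obtain ⟨L, hL, h1⟩ := hν.compact
  refine IsCompactRadon.of_le (ρ := μ.variation + ν.variation) VectorMeasure.variation_add_le
    (hK.union hL) ?_
  rw [Measure.add_apply, measure_mono_null _ h0, measure_mono_null _ h1, add_zero]
  · simp [Set.compl_union]
  · simp [Set.compl_union]

theorem isCompactRadon_of_measure (ρ : Measure G) [IsFiniteMeasure ρ] [ρ.Regular] {K : Set G}
    (hK : IsCompact K) (h0 : ρ Kᶜ = 0) :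
    IsCompactRadon (ρ.toSignedMeasure.toComplexMeasure 0) :=
  IsCompactRadon.of_le (variation_toComplexMeasure_le ρ) hK h0

theorem integrable_of_compact {E : Type*} [NormedAddCommGroup E] [SecondCountableTopology E]
    {ρ : Measure G} [IsFiniteMeasure ρ] {K : Set G} (hK : IsCompact K)
    (h0 : ρ Kᶜ = 0) {f : G → E} (hf : Continuous f) : Integrable f ρ := by
  rw [← Measure.restrict_eq_self_of_ae_mem (s := K) (μ := ρ) (by rw [ae_iff]; exact h0)]
  exact hf.continuousOn.integrableOn_compact hK

theorem IsCompactRadon.integrable {μ : ComplexMeasure G}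
    (hμ : IsCompactRadon μ) {f : G → ℂ} (hf : Continuous f) : Integrable f μ.variation := by
  obtain ⟨K, hK, h0⟩ := hμ.compact
  have := hμ.isFinite
  exact integrable_of_compact hK h0 hf

theorem pairing_add {μ ν : ComplexMeasure G}
    (hμ : IsCompactRadon μ) (hν : IsCompactRadon ν) {f : G → ℂ} (hf : Continuous f) :
    pairing (μ + ν) f = pairing μ f + pairing ν f :=
  VectorMeasure.integral_add_vectorMeasure (hμ.integrable hf) (hν.integrable hf)

theorem pairing_add_right {μ : ComplexMeasure G} (hμ : IsCompactRadon μ) {f g : G → ℂ}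
    (hf : Continuous f) (hg : Continuous g) :
    pairing μ (fun x => f x + g x) = pairing μ f + pairing μ g :=
  setToFun_add _ (hμ.integrable hf) (hμ.integrable hg)

theorem continuous_pairing {μ : ComplexMeasure G} (hμ : IsCompactRadon μ) :
    Continuous fun f : C(G, ℂ) => pairing μ f := by
  obtain ⟨K, hK, h0⟩ := hμ.compact
  have hfin := hμ.isFinite
  have : CompactSpace K := isCompact_iff_compactSpace.mp hK
  have hae : ∀ᵐ x ∂μ.variation, x ∈ K := by rw [ae_iff]; exact h0
  have hbound : ∀ f g : C(G, ℂ), dist (pairing μ f) (pairing μ g) ≤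
      ‖ContinuousLinearMap.mul ℝ ℂ‖ * (dist (f.restrict K) (g.restrict K) *
        μ.variation.real Set.univ) := by
    intro f g
    have hsub : pairing μ f - pairing μ g = pairing μ (fun x => f x - g x) :=
      (setToFun_sub _ (hμ.integrable f.continuous) (hμ.integrable g.continuous)).symm
    rw [dist_eq_norm, hsub]
    refine (VectorMeasure.norm_integral_le_integral_norm).trans ?_
    gcongr
    calc ∫ x, ‖f x - g x‖ ∂μ.variation
        ≤ ∫ _, dist (f.restrict K) (g.restrict K) ∂μ.variation := by
          refine integral_mono_ae ?_ (integrable_const _) ?_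
          · exact (hμ.integrable (by fun_prop : Continuous fun x => f x - g x)).norm
          · filter_upwards [hae] with x hx
            rw [← dist_eq_norm]
            exact ContinuousMap.dist_apply_le_dist (f := f.restrict K) (g := g.restrict K) ⟨x, hx⟩
      _ = _ := by rw [integral_const, smul_eq_mul, mul_comm]
  rw [continuous_iff_continuousAt]
  intro g
  rw [ContinuousAt, tendsto_iff_dist_tendsto_zero]
  refine squeeze_zero (fun _ => dist_nonneg) (fun f => hbound f g) ?_
  have hc : Continuous fun f : C(G, ℂ) => ‖ContinuousLinearMap.mul ℝ ℂ‖ *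
      (dist (f.restrict K) (g.restrict K) * μ.variation.real Set.univ) := by
    have := ContinuousMap.continuous_restrict (Y := ℂ) K
    fun_prop
  have h := hc.tendsto g
  simpa using h

end Measures

section Convolution

set_option linter.unusedSectionVars false

variable {G : Type*} [AddCommGroup G] [TopologicalSpace G] [IsTopologicalAddGroup G]
  [LocallyCompactSpace G] [T2Space G] [MeasurableSpace G] [BorelSpace G]

theorem continuous_integral_translate {σ : Measure G} [IsFiniteMeasure σ] {L : Set G}
    (hL : IsCompact L) (h0 : σ Lᶜ = 0) {f : G → ℝ} (hf : Continuous f) :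
    Continuous fun x => ∫ y, f (x + y) ∂σ := by
  obtain ⟨χ, h1, -, hχ, -⟩ := exists_continuous_one_zero_of_isCompact hL isClosed_empty
    (Set.disjoint_empty L)
  have hae : ∀ᵐ y ∂σ, y ∈ L := by rw [ae_iff]; exact h0
  have : (fun x => ∫ y, f (x + y) ∂σ) = fun x => ∫ y, χ y * f (x + y) ∂σ := by
    ext x
    refine integral_congr_ae ?_
    filter_upwards [hae] with y hy
    rw [h1 hy]; simp
  rw [this, ← continuousOn_univ]
  refine continuousOn_integral_of_compact_support (k := tsupport χ) hχ ?_ ?_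
  · exact Continuous.continuousOn (by unfold Function.uncurry; fun_prop)
  · intro x y _ hy
    rw [image_eq_zero_of_notMem_tsupport hy, zero_mul]

open CompactlySupported in
/-- Existence of the convolution of two positive measures with compact support. -/
theorem exists_conv {ρ σ : Measure G} [IsFiniteMeasure ρ] [IsFiniteMeasure σ] {K L : Set G}
    (hK : IsCompact K) (hρ : ρ Kᶜ = 0) (hL : IsCompact L) (hσ : σ Lᶜ = 0) :
    ∃ τ : Measure G, IsFiniteMeasure τ ∧ τ.Regular ∧ τ (K + L)ᶜ = 0 ∧
      ∀ f : G → ℝ, Continuous f → ∫ z, f z ∂τ = ∫ x, ∫ y, f (x + y) ∂σ ∂ρ := by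
  have i1 : ∀ {f : G → ℝ}, Continuous f → ∀ x, Integrable (fun y => f (x + y)) σ :=
    fun hf x => integrable_of_compact hL hσ (by fun_prop)
  have i2 : ∀ {f : G → ℝ}, Continuous f → Integrable (fun x => ∫ y, f (x + y) ∂σ) ρ :=
    fun hf => integrable_of_compact hK hρ (continuous_integral_translate hL hσ hf)
  have haeK : ∀ᵐ y ∂ρ, y ∈ K := by rw [ae_iff]; exact hρ
  have haeL : ∀ᵐ y ∂σ, y ∈ L := by rw [ae_iff]; exact hσ
  let Λ : C_c(G, ℝ) →ₚ[ℝ] ℝ :=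
    { toFun := fun f => ∫ x, ∫ y, f (x + y) ∂σ ∂ρ
      map_add' := fun f g => by
        have h := integral_add (i2 f.continuous) (i2 g.continuous)
        refine Eq.trans ?_ h
        refine integral_congr_ae (.of_forall fun x => ?_)
        exact integral_add (i1 f.continuous x) (i1 g.continuous x)
      map_smul' := fun c f => by
        simp [integral_const_mul]
      monotone' := fun f g hfg => by
        refine integral_mono (i2 f.continuous) (i2 g.continuous) fun x => ?_
        exact integral_mono (i1 f.continuous x) (i1 g.continuous x) fun y => hfg (x + y) }
  have hΛ : ∀ f : C_c(G, ℝ), Λ f = ∫ x, ∫ y, f (x + y) ∂σ ∂ρ := fun f => rfl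
  set τ := RealRMK.rieszMeasure Λ with hτ
  have hreg : τ.Regular := by rw [hτ]; infer_instance
  have hKL : IsCompact (K + L) := hK.add hL
  have hzero : τ (K + L)ᶜ = 0 := by
    rw [hKL.isClosed.isOpen_compl.measure_eq_iSup_isCompact τ]
    simp only [ENNReal.iSup_eq_zero]
    intro C hCU hC
    obtain ⟨f, hf1, hf0, hfc, hfI⟩ := exists_continuous_one_zero_of_isCompact hC hKL.isClosed
      (Set.disjoint_left.mpr hCU)
    have h := RealRMK.rieszMeasure_le_of_eq_one Λ (f := ⟨f, hfc⟩) (fun x => (hfI x).1) hC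
      (fun x hx => hf1 hx)
    have hz : Λ ⟨f, hfc⟩ = 0 := by
      rw [hΛ]
      refine integral_eq_zero_of_ae ?_
      filter_upwards [haeK] with x hx
      refine integral_eq_zero_of_ae ?_
      filter_upwards [haeL] with y hy
      exact hf0 (Set.add_mem_add hx hy)
    rw [hz, ENNReal.ofReal_zero] at h
    exact le_antisymm h bot_le
  have hfin : IsFiniteMeasure τ := by
    constructor
    calc τ Set.univ ≤ τ ((K + L) ∪ (K + L)ᶜ) := by simp
      _ ≤ τ (K + L) + τ (K + L)ᶜ := measure_union_le _ _
      _ < ⊤ := by rw [hzero, add_zero]; exact hKL.measure_lt_top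
  refine ⟨τ, hfin, hreg, hzero, fun f hf => ?_⟩
  obtain ⟨χ, h1, -, hχ, -⟩ := exists_continuous_one_zero_of_isCompact hKL isClosed_empty
    (Set.disjoint_empty _)
  let g : C_c(G, ℝ) := ⟨⟨fun x => χ x * f x, by fun_prop⟩, hχ.mul_right⟩
  have hae : ∀ᵐ z ∂τ, z ∈ K + L := by rw [ae_iff]; exact hzero
  calc ∫ z, f z ∂τ = ∫ z, g z ∂τ := by
        refine integral_congr_ae ?_
        filter_upwards [hae] with z hz
        change f z = χ z * f z
        rw [h1 hz]; simp
    _ = ∫ x, ∫ y, g (x + y) ∂σ ∂ρ := by rw [hτ, RealRMK.integral_rieszMeasure, hΛ]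
    _ = ∫ x, ∫ y, f (x + y) ∂σ ∂ρ := by
        refine integral_congr_ae ?_
        filter_upwards [haeK] with x hx
        refine integral_congr_ae ?_
        filter_upwards [haeL] with y hy
        change χ (x + y) * f (x + y) = f (x + y)
        rw [h1 (Set.add_mem_add hx hy)]; simp

/-- Convolution of positive measures, tested on multiplicative functions. -/
theorem exists_conv_mul {ρ σ : Measure G} [IsFiniteMeasure ρ] [IsFiniteMeasure σ] {K L : Set G}
    (hK : IsCompact K) (hρ : ρ Kᶜ = 0) (hL : IsCompact L) (hσ : σ Lᶜ = 0) :
    ∃ τ : Measure G, IsFiniteMeasure τ ∧ τ.Regular ∧ (∃ M : Set G, IsCompact M ∧ τ Mᶜ = 0) ∧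
      ∀ e : G → ℂ, Continuous e → (∀ x y, e (x + y) = e x * e y) →
        ∫ z, e z ∂τ = (∫ x, e x ∂ρ) * ∫ y, e y ∂σ := by
  obtain ⟨τ, hfin, hreg, hzero, hint⟩ := exists_conv hK hρ hL hσ
  refine ⟨τ, hfin, hreg, ⟨K + L, hK.add hL, hzero⟩, fun e he hmul => ?_⟩
  have hcomm : ∀ (ℓ : ℂ →L[ℝ] ℝ), ℓ (∫ z, e z ∂τ) = ℓ ((∫ x, e x ∂ρ) * ∫ y, e y ∂σ) := by
    intro ℓ
    rw [← ℓ.integral_comp_comm (integrable_of_compact (hK.add hL) hzero he),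
      hint (fun z => ℓ (e z)) (by fun_prop), ← integral_mul_const,
      ← ℓ.integral_comp_comm
        ((integrable_of_compact hK hρ he).mul_const _)]
    refine integral_congr_ae (.of_forall fun x => ?_)
    simp only
    rw [ℓ.integral_comp_comm (integrable_of_compact hL hσ (by fun_prop)), ← integral_const_mul]
    simp [hmul]
  exact Complex.ext (hcomm Complex.reCLM) (hcomm Complex.imCLM)

end Convolution

/-! ## The space of measures with its weak-* topology -/

section MeasureSpace

variable (G : Type*) [TopologicalSpace G] [T2Space G] [MeasurableSpace G] [BorelSpace G]

/-- The space of all compactly supported (regular) complex Borel measures on `G`. -/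
def compactMeasures : Submodule ℂ (ComplexMeasure G) where
  carrier := {μ | IsCompactRadon μ}
  add_mem' := IsCompactRadon.add
  zero_mem' := IsCompactRadon.zero
  smul_mem' := fun c _ h => h.smul c

variable {G} in
theorem isCompactRadon (μ : compactMeasures G) : IsCompactRadon μ.1 := μ.2

/-- The weak-* topology: the coarsest topology that makes `μ ↦ ∫ f dμ` continuous for every
continuous complex function `f`. -/
instance weakStarTopology : TopologicalSpace (compactMeasures G) :=
  TopologicalSpace.induced (fun (μ : compactMeasures G) (f : C(G, ℂ)) => pairing μ.1 f) inferInstance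

end MeasureSpace

/-! ## Exponentials and the Fourier algebra -/

/-- Exponentials: the continuous homomorphisms of `G` into the multiplicative group of nonzero
complex numbers. -/
def Exponential (G : Type*) [AddCommGroup G] [TopologicalSpace G] : Type _ :=
  {m : AddChar G ℂ // Continuous m}

theorem Exponential.continuous_neg {G : Type*} [AddCommGroup G] [TopologicalSpace G]
    [IsTopologicalAddGroup G] (m : Exponential G) : Continuous fun x => m.1 (-x) :=
  m.2.comp continuous_id.neg

/-- The Fourier-Laplace transform `m ↦ ∫ m(-x) dμ(x)` of a measure. -/
def fourierLaplace {G : Type*} [AddCommGroup G] [TopologicalSpace G] [MeasurableSpace G]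
    (μ : ComplexMeasure G) (m : Exponential G) : ℂ :=
  pairing μ fun x => m.1 (-x)

section FourierAlgebra

variable {G : Type*} [AddCommGroup G] [TopologicalSpace G] [IsTopologicalAddGroup G]
  [T2Space G] [MeasurableSpace G] [BorelSpace G]

theorem fourierLaplace_add {μ ν : ComplexMeasure G} (hμ : IsCompactRadon μ)
    (hν : IsCompactRadon ν) : fourierLaplace (μ + ν) = fourierLaplace μ + fourierLaplace ν := by
  ext m
  exact pairing_add hμ hν m.continuous_neg

theorem fourierLaplace_smul {μ : ComplexMeasure G} (c : ℂ) (hμ : IsCompactRadon μ) :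
    fourierLaplace (c • μ) = c • fourierLaplace μ := by
  ext m
  exact pairing_smul c (hμ.integrable m.continuous_neg)

variable (G) in
/-- The Fourier-Laplace transform as a linear map. -/
def fourierLinear : compactMeasures G →ₗ[ℂ] (Exponential G → ℂ) where
  toFun μ := fourierLaplace μ.1
  map_add' μ ν := fourierLaplace_add μ.2 ν.2
  map_smul' c μ := fourierLaplace_smul c μ.2

/-- A transform is a linear combination of transforms of positive measures. -/
theorem fourierLaplace_mem_span {μ : ComplexMeasure G} (hμ : IsCompactRadon μ) :
    fourierLaplace μ ∈ Submodule.span ℂ {φ : Exponential G → ℂ | ∃ ρ : Measure G,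
      IsFiniteMeasure ρ ∧ ρ.Regular ∧ (∃ K : Set G, IsCompact K ∧ ρ Kᶜ = 0) ∧
        φ = fun m => ∫ x, m.1 (-x) ∂ρ} := by
  have := hμ.isFinite
  have := hμ.regular
  obtain ⟨K, hK, h0⟩ := hμ.compact
  obtain ⟨ρ, hfin, hle, c, hc⟩ := eq_comb_of_measures μ
  have h0' : ∀ i, ρ i Kᶜ = 0 := fun i => le_antisymm ((hle i _).trans h0.le) bot_le
  have hreg : ∀ i, (ρ i).Regular := fun i => regular_of_le (hle i)
  have hrad := fun i => isCompactRadon_of_measure (ρ i) hK (h0' i)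
  have hsum : (⟨μ, hμ⟩ : compactMeasures G) = ∑ i, c i • ⟨_, hrad i⟩ := by
    apply Subtype.ext
    rw [Submodule.coe_sum]
    exact hc
  have : fourierLaplace μ = fourierLinear G ⟨μ, hμ⟩ := rfl
  rw [this, hsum, map_sum]
  refine Submodule.sum_mem _ fun i _ => ?_
  rw [map_smul]
  refine Submodule.smul_mem _ _ (Submodule.subset_span
    ⟨ρ i, hfin i, hreg i, ⟨K, hK, h0' i⟩, ?_⟩)
  ext m
  exact pairing_of_measure (ρ i) (integrable_of_compact hK (h0' i) m.continuous_neg)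

theorem exists_of_mem_span {φ : Exponential G → ℂ}
    (h : φ ∈ Submodule.span ℂ {φ : Exponential G → ℂ | ∃ ρ : Measure G,
      IsFiniteMeasure ρ ∧ ρ.Regular ∧ (∃ K : Set G, IsCompact K ∧ ρ Kᶜ = 0) ∧
        φ = fun m => ∫ x, m.1 (-x) ∂ρ}) :
    φ ∈ LinearMap.range (fourierLinear G) := by
  refine Submodule.span_le.mpr ?_ h
  rintro _ ⟨ρ, hfin, hreg, ⟨K, hK, h0⟩, rfl⟩
  refine ⟨⟨_, isCompactRadon_of_measure ρ hK h0⟩, ?_⟩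
  ext m
  exact pairing_of_measure ρ (integrable_of_compact hK h0 m.continuous_neg)

theorem fourierLaplace_mul [LocallyCompactSpace G] {φ ψ : Exponential G → ℂ}
    (hφ : φ ∈ LinearMap.range (fourierLinear G)) (hψ : ψ ∈ LinearMap.range (fourierLinear G)) :
    φ * ψ ∈ LinearMap.range (fourierLinear G) := by
  obtain ⟨μ, rfl⟩ := hφ
  obtain ⟨ν, rfl⟩ := hψ
  apply exists_of_mem_span
  have h := Submodule.mul_mem_mul (fourierLaplace_mem_span μ.2) (fourierLaplace_mem_span ν.2)
  rw [Submodule.span_mul_span] at h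
  refine Submodule.span_mono ?_ h
  rintro _ ⟨_, ⟨ρ, _, _, ⟨K, hK, h0⟩, rfl⟩, _, ⟨σ, _, _, ⟨L, hL, h1⟩, rfl⟩, rfl⟩
  obtain ⟨τ, hfin, hreg, hM, hτ⟩ := exists_conv_mul hK h0 hL h1
  refine ⟨τ, hfin, hreg, hM, ?_⟩
  ext m
  refine (hτ _ m.continuous_neg fun x y => ?_).symm
  rw [neg_add, AddChar.map_add_eq_mul]

theorem one_mem_range : (1 : Exponential G → ℂ) ∈ LinearMap.range (fourierLinear G) := by
  have h0 : Measure.dirac (0 : G) ({0} : Set G)ᶜ = 0 := by simp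
  have : (Measure.dirac (0 : G)).Regular := by
    have : (Measure.dirac (0 : G)).InnerRegularCompactLTTop := by
      constructor
      rintro A ⟨hA, -⟩ r hr
      have hmem : (0 : G) ∈ A := by
        by_contra h
        rw [Measure.dirac_apply' _ hA, Set.indicator_of_notMem h] at hr
        exact absurd hr (by simp)
      refine ⟨{0}, by simpa using hmem, isCompact_singleton, ?_⟩
      refine hr.trans_le ?_
      rw [Measure.dirac_apply_of_mem (Set.mem_singleton _)]
      exact prob_le_one
    infer_instance
  refine ⟨⟨_, isCompactRadon_of_measure (Measure.dirac (0 : G)) isCompact_singleton h0⟩, ?_⟩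
  ext m
  refine (pairing_of_measure (Measure.dirac (0 : G))
    (integrable_of_compact isCompact_singleton h0 m.continuous_neg)).trans ?_
  rw [integral_dirac]
  simp

variable [LocallyCompactSpace G]

variable (G) in
/-- The set of all Fourier-Laplace transforms of compactly supported measures, as an algebra of
functions on the set of exponentials. -/
def fourierSubalgebra : Subalgebra ℂ (Exponential G → ℂ) where
  carrier := {φ | ∃ μ : compactMeasures G, fourierLinear G μ = φ}
  mul_mem' := fourierLaplace_mul
  one_mem' := one_mem_range
  add_mem' := (LinearMap.range (fourierLinear G)).add_mem
  zero_mem' := (LinearMap.range (fourierLinear G)).zero_mem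
  algebraMap_mem' := fun c => by
    rw [Algebra.algebraMap_eq_smul_one]
    exact (LinearMap.range (fourierLinear G)).smul_mem c one_mem_range

variable (G) in
/-- The Fourier algebra of `G`. It is a separate type, so that it does not inherit the topology of
pointwise convergence. -/
def FourierAlgebra : Type _ := fourierSubalgebra G

instance : CommRing (FourierAlgebra G) := inferInstanceAs (CommRing (fourierSubalgebra G))

instance : Algebra ℂ (FourierAlgebra G) := inferInstanceAs (Algebra ℂ (fourierSubalgebra G))

/-- The value of an element of the Fourier algebra at an exponential. -/
def FourierAlgebra.eval (φ : FourierAlgebra G) (m : Exponential G) : ℂ := φ.1 m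

/-- The map `μ ↦ μ̂` onto the Fourier algebra. -/
def transform (μ : compactMeasures G) : FourierAlgebra G := ⟨fourierLinear G μ, μ, rfl⟩

/-- The topology of the Fourier algebra, carried over from the weak-* topology of the space of
measures along `μ ↦ μ̂`. -/
instance : TopologicalSpace (FourierAlgebra G) :=
  TopologicalSpace.coinduced transform (weakStarTopology G)

/-! ## Derivations -/

/-- Derivations of order one: nonzero continuous linear operators that satisfy the product rule. -/
structure IsFirstOrderDerivation (D : Module.End ℂ (FourierAlgebra G)) : Prop where
  ne_zero : D ≠ 0
  continuous : Continuous D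
  leibniz : ∀ a b, D (a * b) = D a * b + a * D b

variable (G) in
/-- Polynomial derivations: the algebra of operators generated by the identity and all first order
derivations. -/
def polynomialDerivations : Subalgebra ℂ (Module.End ℂ (FourierAlgebra G)) :=
  Algebra.adjoin ℂ {D | IsFirstOrderDerivation D}

/-- The zero set of an ideal: its roots. -/
def roots (I : Ideal (FourierAlgebra G)) : Set (Exponential G) :=
  {m | ∀ φ ∈ I, φ.eval m = 0}

/-- The polynomial derivations that annihilate the ideal `I` at `m`. -/
def annihilatingDerivations (I : Ideal (FourierAlgebra G)) (m : Exponential G) :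
    Set (Module.End ℂ (FourierAlgebra G)) :=
  {D | D ∈ polynomialDerivations G ∧ ∀ φ ∈ I, (D φ).eval m = 0}

/-- An ideal is localizable if it contains every function that is annihilated, at each root `m` of
the ideal, by all polynomial derivations that annihilate the ideal at `m`. -/
def IsLocalizable (I : Ideal (FourierAlgebra G)) : Prop :=
  ∀ φ : FourierAlgebra G,
    (∀ m ∈ roots I, ∀ D ∈ annihilatingDerivations I m, (D φ).eval m = 0) → φ ∈ I

end FourierAlgebra

/-! ## Varieties -/

section Varieties

variable {G : Type*} [AddCommGroup G] [TopologicalSpace G] [IsTopologicalAddGroup G]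

/-- A variety is a closed translation invariant linear subspace of the space of continuous complex
functions with the topology of uniform convergence on compact sets. -/
structure IsVariety (V : Submodule ℂ C(G, ℂ)) : Prop where
  isClosed : IsClosed (V : Set C(G, ℂ))
  translate_mem : ∀ f ∈ V, ∀ y : G, f.comp ⟨fun x => x + y, by fun_prop⟩ ∈ V

/-- `V` is synthesizable if the finite dimensional varieties contained in `V` together span a dense
subspace of `V`. -/
def IsSynthesizable (V : Submodule ℂ C(G, ℂ)) : Prop :=
  (V : Set C(G, ℂ)) ⊆ closure
    ((sSup {W : Submodule ℂ C(G, ℂ) | IsVariety W ∧ FiniteDimensional ℂ W ∧ W ≤ V} :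
      Submodule ℂ C(G, ℂ)) : Set C(G, ℂ))

variable [T2Space G] [MeasurableSpace G] [BorelSpace G]

/-- The convolution `(μ * f)(x) = ∫ f(x - y) dμ(y)`. -/
def convolve (μ : ComplexMeasure G) (f : C(G, ℂ)) (x : G) : ℂ :=
  pairing μ fun y => f (x - y)

/-- The annihilator `Ann H` of a set of measures: the continuous functions `f` with `μ * f = 0` for
every `μ` in `H`. -/
def annihilator (H : Set (compactMeasures G)) : Submodule ℂ C(G, ℂ) where
  carrier := {f | ∀ μ ∈ H, ∀ x, convolve μ.1 f x = 0}
  add_mem' := fun {f g} hf hg μ hμ x => by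
    have h := pairing_add_right μ.2 (f := fun y => f (x - y)) (g := fun y => g (x - y))
      (by fun_prop) (by fun_prop)
    exact h.trans (by rw [show pairing μ.1 (fun y => f (x - y)) = 0 from hf μ hμ x,
      show pairing μ.1 (fun y => g (x - y)) = 0 from hg μ hμ x, add_zero])
  zero_mem' := fun μ _ x => by
    have h := pairing_smul_right μ.1 0 (fun _ : G => (0 : ℂ))
    simp only [zero_mul] at h
    exact h
  smul_mem' := fun c f hf μ hμ x => by
    have h := pairing_smul_right μ.1 c (fun y => f (x - y))
    exact h.trans (by rw [show pairing μ.1 (fun y => f (x - y)) = 0 from hf μ hμ x, mul_zero])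

theorem mem_annihilator {H : Set (compactMeasures G)} {f : C(G, ℂ)} :
    f ∈ annihilator H ↔ ∀ μ ∈ H, ∀ x, convolve μ.1 f x = 0 :=
  Iff.rfl

theorem continuous_convolve (μ : compactMeasures G) (x : G) :
    Continuous fun f : C(G, ℂ) => convolve μ.1 f x := by
  have h1 : Continuous fun f : C(G, ℂ) => f.comp (⟨fun y => x - y, by fun_prop⟩ : C(G, G)) :=
    ContinuousMap.continuous_precomp _
  have h2 : Continuous fun f : C(G, ℂ) => pairing μ.1 f := continuous_pairing (isCompactRadon μ)
  refine (h2.comp h1).congr fun f => ?_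
  unfold convolve
  have : ⇑(f.comp (⟨fun y => x - y, by fun_prop⟩ : C(G, G))) = fun y => f (x - y) := rfl
  rw [← this]
  rfl

set_option linter.unusedSectionVars false in
theorem convolve_translate (μ : ComplexMeasure G) (f : C(G, ℂ)) (x y : G) :
    convolve μ (f.comp ⟨fun x => x + y, by fun_prop⟩) x = convolve μ f (x + y) := by
  unfold convolve
  have : (fun z => (f.comp ⟨fun x => x + y, by fun_prop⟩) (x - z)) = fun z => f (x + y - z) := by
    funext z
    change f (x - z + y) = f (x + y - z)
    rw [sub_add_eq_add_sub]
  rw [this]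

/-- The annihilator of a set of measures is a variety. -/
theorem isVariety_annihilator (H : Set (compactMeasures G)) : IsVariety (annihilator H) := by
  constructor
  · have : ((annihilator H : Submodule ℂ C(G, ℂ)) : Set C(G, ℂ)) =
        ⋂ μ ∈ H, ⋂ x : G, {f | convolve μ.1 f x = 0} := by
      ext f
      simp only [SetLike.mem_coe, mem_annihilator, Set.mem_iInter, Set.mem_ofPred_eq]
    rw [this]
    exact isClosed_biInter fun μ _ => isClosed_iInter fun x =>
      isClosed_eq (continuous_convolve μ x) continuous_const
  · intro f hf y
    rw [mem_annihilator] at hf ⊢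
    intro μ hμ x
    rw [convolve_translate]
    exact hf μ hμ (x + y)

end Varieties

end SpectralSynthesis

end

/-!
The argument rests on the duality between `C(G, ℂ)` and the space of compactly supported measures
with its weak-* topology. Each space is the continuous dual of the other: `exists_pairing_eq` is the
Riesz representation theorem on `C(G, ℂ)`, obtained from the theorem for positive functionals by a
Jordan decomposition, and `exists_eq_pairing_of_continuous` is the general fact about weak
topologies. By the Hahn-Banach theorem closed subspaces on either side are determined by their
annihilators. As an ideal is stable under multiplication by transforms of point masses, `f` belongs
to `Ann I` if and only if its reflection `x ↦ f (-x)` is orthogonal to `I` (`mem_annihilator_iff`).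

It remains to compare finite dimensional varieties with polynomial derivations.

* For a polynomial derivation `D` and an exponential `m`, the functional `μ ↦ D(μ̂)(m)` is
  integration against the reflection of a continuous function `f`, where `f (-x)` is the value at
  `m` of `D` applied to the transform of the point mass at `x`. The iterated Leibniz rule
  `D(ab) = ∑ Pᵢ(a) Qᵢ(b)`, applied to the transforms of two point masses, shows that the translates
  of `f` span a finite dimensional space (`exists_translate_mem_finiteDimensional`). If `D`
  annihilates the ideal at `m`, then the span of the translates is a variety contained in `Ann I`.
  Hence the transform of a measure orthogonal to the reflections of all functions in finite
  dimensional subvarieties of `Ann I` satisfies the conditions in the definition of localizability.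

* Conversely, a finite dimensional variety is spanned by products `p m` that it contains, where `m`
  is an exponential in the variety and `p` is a polynomial in continuous additive functions
  (`le_span_polynomial_mul_exponential`). This follows from the decomposition into joint generalized
  eigenspaces of the translations: divided by its eigenvalue, the action of `G` on such a space is
  unipotent, so it is the exponential of its logarithm, which is additive. For a continuous additive
  function `a` the map `μ̂ ↦ (a μ)^` is, up to sign, the derivative at `t = 0` along the families
  `m * exp (t * a)` of exponentials. It is thus well defined and satisfies the Leibniz rule, and
  multiplication of measures by `p` is a polynomial derivation (`exists_polynomialDerivation`). So
  the functionals given by the functions `p m` in `Ann I` are among those that test localizability.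

The injectivity of the transform plays no role.
-/

noncomputable section

namespace SpectralSynthesis

/-! ### The Riesz representation of continuous functionals on `C(X, ℂ)` -/

section Riesz

open CompactlySupported CompactlySupportedContinuousMap
open scoped NNReal

variable {X : Type*} [TopologicalSpace X]

/-- Jordan decomposition: a linear functional that is bounded on order intervals is the difference
of two positive functionals. The positive part at `f` is the supremum of the values of the
functional at the functions between `0` and `f`. The second conclusion says that both parts vanish
at `f` if the functional vanishes at all functions between `0` and `f`. -/
theorem exists_positive_sub_positive (L : C_c(X, ℝ) →ₗ[ℝ] ℝ)
    (hL : ∀ f : C_c(X, ℝ≥0), ∃ M, ∀ g ≤ f, L g.toReal ≤ M) :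
    ∃ P N : C_c(X, ℝ≥0) →ₗ[ℝ≥0] ℝ≥0, (∀ f, L f.toReal = P f - N f) ∧
      ∀ f, (∀ g ≤ f, L g.toReal = 0) → P f = 0 ∧ N f = 0 := by
  let S : C_c(X, ℝ≥0) → Set ℝ := fun f => {c | ∃ g ≤ f, L g.toReal = c}
  let p : C_c(X, ℝ≥0) → ℝ := fun f => sSup (S f)
  have zero_le' : ∀ f : C_c(X, ℝ≥0), 0 ≤ f := fun f x => bot_le
  have toReal_zero : (0 : C_c(X, ℝ≥0)).toReal = 0 := by ext; simp
  have hbdd : ∀ f, BddAbove (S f) := fun f => by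
    obtain ⟨M, hM⟩ := hL f
    exact ⟨M, by rintro _ ⟨g, hg, rfl⟩; exact hM g hg⟩
  have hne : ∀ f, (S f).Nonempty := fun f => ⟨_, 0, zero_le' f, rfl⟩
  have hle : ∀ {f g : C_c(X, ℝ≥0)}, g ≤ f → L g.toReal ≤ p f := fun {f g} h =>
    le_csSup (hbdd f) ⟨g, h, rfl⟩
  have hp_le : ∀ {f : C_c(X, ℝ≥0)} {c : ℝ}, (∀ g ≤ f, L g.toReal ≤ c) → p f ≤ c :=
    fun {f c} h => csSup_le (hne f) (by rintro _ ⟨g, hg, rfl⟩; exact h g hg)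
  have hp0 : ∀ f, 0 ≤ p f := fun f => by
    simpa [toReal_zero] using hle (zero_le' f)
  have hadd : ∀ f₁ f₂, p (f₁ + f₂) = p f₁ + p f₂ := by
    intro f₁ f₂
    apply le_antisymm
    · refine hp_le fun g hg => ?_
      obtain ⟨g₂, hg₂⟩ := CompactlySupportedContinuousMap.exists_add_of_le
        (f₁ := g ⊓ f₁) (f₂ := g) (fun x => inf_le_left)
      have h2 : g₂ ≤ f₂ := by
        intro x
        have h1 : (g ⊓ f₁) x + g₂ x = g x := DFunLike.congr_fun hg₂ x
        have h3 : g x ≤ f₁ x + f₂ x := hg x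
        rw [inf_apply] at h1
        rcases le_total (g x) (f₁ x) with h | h
        · rw [inf_eq_left.mpr h] at h1
          have : g₂ x = 0 := by simpa using h1
          exact this.le.trans bot_le
        · rw [inf_eq_right.mpr h] at h1
          rw [← h1] at h3
          exact le_of_add_le_add_left h3
      rw [← hg₂, toReal_add, map_add]
      exact add_le_add (hle fun x => inf_le_right) (hle h2)
    · have key : ∀ g₁ ≤ f₁, ∀ g₂ ≤ f₂, L g₁.toReal + L g₂.toReal ≤ p (f₁ + f₂) := by
        intro g₁ h₁ g₂ h₂
        rw [← map_add, ← toReal_add]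
        exact hle fun x => add_le_add (h₁ x) (h₂ x)
      have h1 : ∀ g₁ ≤ f₁, p f₂ ≤ p (f₁ + f₂) - L g₁.toReal := fun g₁ h₁ =>
        hp_le fun g₂ h₂ => by linarith [key g₁ h₁ g₂ h₂]
      have h2 : p f₁ ≤ p (f₁ + f₂) - p f₂ := hp_le fun g₁ h₁ => by linarith [h1 g₁ h₁]
      linarith
  have hsmul_le : ∀ (r : ℝ≥0) f, p (r • f) ≤ r * p f := by
    intro r f
    refine hp_le fun g hg => ?_
    rcases eq_or_ne r 0 with rfl | hr
    · have : g = 0 := by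
        ext x
        have := hg x
        simpa using this
      simp [this, toReal_zero]
    · have h1 : r⁻¹ • g ≤ f := by
        intro x
        have h2 : g x ≤ r * f x := hg x
        change r⁻¹ * g x ≤ f x
        rw [inv_mul_le_iff₀ (pos_of_ne_zero hr)]
        exact h2
      have h3 : g = r • (r⁻¹ • g) := by rw [smul_smul, mul_inv_cancel₀ hr, one_smul]
      have h4 : L g.toReal = r * L (r⁻¹ • g).toReal := by
        conv_lhs => rw [h3]
        rw [toReal_smul, NNReal.smul_def, map_smul, smul_eq_mul]
      rw [h4]
      exact mul_le_mul_of_nonneg_left (hle h1) r.2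
  have hsmul : ∀ (r : ℝ≥0) f, p (r • f) = r * p f := by
    intro r f
    refine le_antisymm (hsmul_le r f) ?_
    rcases eq_or_ne r 0 with rfl | hr
    · simpa using hp0 _
    · have h := hsmul_le r⁻¹ (r • f)
      rw [smul_smul, inv_mul_cancel₀ hr, one_smul, NNReal.coe_inv] at h
      have hr' : (0 : ℝ) < r := by exact_mod_cast pos_of_ne_zero hr
      rwa [← div_eq_inv_mul, le_div_iff₀' hr'] at h
  have hN0 : ∀ f : C_c(X, ℝ≥0), 0 ≤ p f - L f.toReal := fun f => sub_nonneg.mpr (hle le_rfl)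
  refine ⟨{ toFun := fun f => ⟨p f, hp0 f⟩, map_add' := fun f g => NNReal.eq (hadd f g),
            map_smul' := fun r f => NNReal.eq (hsmul r f) },
          -- the negative part is the difference of the positive part and the functional
          { toFun := fun f => ⟨p f - L f.toReal, hN0 f⟩
            map_add' := fun f g => NNReal.eq ?_
            map_smul' := fun r f => NNReal.eq ?_ }, fun f => ?_, fun f hf => ?_⟩
  · change p (f + g) - L (f + g).toReal = (p f - L f.toReal) + (p g - L g.toReal)
    rw [hadd, toReal_add, map_add]; ring
  · change p (r • f) - L (r • f).toReal = r * (p f - L f.toReal)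
    rw [hsmul, toReal_smul, NNReal.smul_def, map_smul, smul_eq_mul]; ring
  · change L f.toReal = p f - (p f - L f.toReal)
    ring
  · have h1 : p f = 0 := le_antisymm (hp_le fun g hg => (hf g hg).le) (hp0 f)
    refine ⟨NNReal.eq h1, NNReal.eq ?_⟩
    change p f - L f.toReal = 0
    rw [h1, hf f le_rfl, sub_zero]

/-- A continuous functional on `C(X, ℂ)` is bounded by the supremum over some compact set. -/
theorem exists_isCompact_norm_apply_le (ℓ : C(X, ℂ) →L[ℂ] ℂ) :
    ∃ K : Set X, IsCompact K ∧ ∃ C : ℝ, ∀ (f : C(X, ℂ)) (r : ℝ), 0 ≤ r → (∀ x ∈ K, ‖f x‖ ≤ r) →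
      ‖ℓ f‖ ≤ C * r := by
  have hbasis := (Metric.nhds_basis_ball (x := (0 : ℂ))).nhds_continuousMapConst (X := X)
  have h0 : ℓ ⁻¹' Metric.ball 0 1 ∈ 𝓝 (ContinuousMap.const X (0 : ℂ)) :=
    ℓ.continuous.continuousAt.preimage_mem_nhds
      (by rw [show ContinuousMap.const X (0 : ℂ) = 0 from rfl, map_zero]
          exact Metric.ball_mem_nhds _ one_pos)
  obtain ⟨⟨K, ε⟩, ⟨hK, hε⟩, hsub⟩ := hbasis.mem_iff.mp h0
  simp only at hK hε hsub
  refine ⟨K, hK, 2 / ε, fun f r hr hf => ?_⟩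
  suffices h : ‖ℓ f‖ * (ε / 2) ≤ r by
    rw [div_mul_eq_mul_div, le_div_iff₀ hε]
    linarith
  refine le_of_forall_gt_imp_ge_of_dense fun t ht => ?_
  have ht0 : 0 < t := hr.trans_lt ht
  have hmem : (((ε / 2 / t : ℝ) : ℂ) • f) ∈ ℓ ⁻¹' Metric.ball 0 1 := by
    refine hsub fun x hx => ?_
    rw [mem_ball_zero_iff]
    change ‖((ε / 2 / t : ℝ) : ℂ) * f x‖ < ε
    rw [norm_mul, Complex.norm_real, Real.norm_of_nonneg (by positivity)]
    calc ε / 2 / t * ‖f x‖ ≤ ε / 2 / t * t := by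
          gcongr; exact (hf x hx).trans ht.le
      _ = ε / 2 := by field_simp
      _ < ε := by linarith
  rw [Set.mem_preimage, map_smul, mem_ball_zero_iff, norm_smul, Complex.norm_real,
    Real.norm_of_nonneg (by positivity), div_mul_eq_mul_div, div_lt_one ht0, mul_comm] at hmem
  exact hmem.le

variable [T2Space X] [LocallyCompactSpace X] [MeasurableSpace X] [BorelSpace X]

/-- The measure of a positive functional that only depends on the restriction to the compact set
`K` vanishes outside `K`. -/
theorem rieszMeasure_compl_eq_zero {P : C_c(X, ℝ≥0) →ₗ[ℝ≥0] ℝ≥0} {K : Set X} (hK : IsCompact K)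
    (hP : ∀ f : C_c(X, ℝ≥0), (∀ x ∈ K, f x = 0) → P f = 0) :
    NNRealRMK.rieszMeasure P Kᶜ = 0 := by
  rw [hK.isClosed.isOpen_compl.measure_eq_iSup_isCompact]
  simp only [ENNReal.iSup_eq_zero]
  intro C hCU hC
  obtain ⟨f, hf1, hf0, hfc, hfI⟩ := exists_continuous_one_zero_of_isCompact hC hK.isClosed
    (Set.disjoint_left.mpr hCU)
  let g : C_c(X, ℝ≥0) := nnrealPart ⟨f, hfc⟩
  have hg : P g = 0 := hP g fun x hx => by
    change Real.toNNReal (f x) = 0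
    rw [hf0 hx]; simp
  have h := NNRealRMK.lintegral_rieszMeasure P g
  rw [hg] at h
  refine le_antisymm ?_ bot_le
  calc NNRealRMK.rieszMeasure P C = ∫⁻ _ in C, 1 ∂NNRealRMK.rieszMeasure P := by simp
    _ ≤ ∫⁻ x in C, g x ∂NNRealRMK.rieszMeasure P := by
        refine setLIntegral_mono' hC.measurableSet fun x hx => ?_
        change 1 ≤ ((Real.toNNReal (f x) : ℝ≥0) : ENNReal)
        rw [hf1 hx]; simp
    _ ≤ ∫⁻ x, g x ∂NNRealRMK.rieszMeasure P := setLIntegral_le_lintegral _ _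
    _ = 0 := by rw [h]; rfl

/-- A real functional that is bounded by the supremum over a compact set `K` is integration against
the difference of two finite regular measures concentrated on `K`. -/
theorem exists_measure_sub_measure (L : C(X, ℝ) →ₗ[ℝ] ℝ) {K : Set X} (hK : IsCompact K) {C : ℝ}
    (hL : ∀ (f : C(X, ℝ)) (r : ℝ), 0 ≤ r → (∀ x ∈ K, |f x| ≤ r) → |L f| ≤ C * r) :
    ∃ ρ σ : Measure X, (IsFiniteMeasure ρ ∧ ρ.Regular ∧ ρ Kᶜ = 0) ∧
      (IsFiniteMeasure σ ∧ σ.Regular ∧ σ Kᶜ = 0) ∧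
      ∀ f : C(X, ℝ), L f = ∫ x, f x ∂ρ - ∫ x, f x ∂σ := by
  have hL0 : ∀ f : C(X, ℝ), (∀ x ∈ K, f x = 0) → L f = 0 := fun f hf => by
    have := hL f 0 le_rfl fun x hx => by simp [hf x hx]
    simpa using this
  let L' : C_c(X, ℝ) →ₗ[ℝ] ℝ :=
    { toFun := fun f => L f.toContinuousMap
      map_add' := fun f g => L.map_add f.toContinuousMap g.toContinuousMap
      map_smul' := fun c f => L.map_smul c f.toContinuousMap }
  obtain ⟨P, N, hPN, h0⟩ := exists_positive_sub_positive L' (fun f => by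
    obtain ⟨r, hr⟩ := hK.exists_bound_of_continuousOn
      (f := fun x => (f x : ℝ)) (by fun_prop)
    refine ⟨C * |r|, fun g hg => (le_abs_self _).trans (hL _ |r| (abs_nonneg r) fun x hx => ?_)⟩
    have h1 : (f x : ℝ) ≤ |r| := ((le_abs_self _).trans (hr x hx)).trans (le_abs_self r)
    have h2 : (g x : ℝ) ≤ f x := by exact_mod_cast hg x
    rw [show g.toReal.toContinuousMap x = g x from toReal_apply g x, NNReal.abs_eq]
    exact h2.trans h1)
  have hz : ∀ f : C_c(X, ℝ≥0), (∀ x ∈ K, f x = 0) → P f = 0 ∧ N f = 0 := by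
    refine fun f hf => h0 f fun g hg => hL0 _ fun x hx => ?_
    have h1 : g x ≤ f x := hg x
    rw [hf x hx] at h1
    have : g x = 0 := le_antisymm h1 bot_le
    rw [show g.toReal.toContinuousMap x = g x from toReal_apply g x, this]; rfl
  have hfin : ∀ Q : C_c(X, ℝ≥0) →ₗ[ℝ≥0] ℝ≥0, NNRealRMK.rieszMeasure Q Kᶜ = 0 →
      IsFiniteMeasure (NNRealRMK.rieszMeasure Q) := by
    intro Q hQ
    constructor
    calc NNRealRMK.rieszMeasure Q Set.univ ≤ NNRealRMK.rieszMeasure Q (K ∪ Kᶜ) := by simp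
      _ ≤ NNRealRMK.rieszMeasure Q K + NNRealRMK.rieszMeasure Q Kᶜ := measure_union_le _ _
      _ < ⊤ := by rw [hQ, add_zero]; exact hK.measure_lt_top
  have hP := rieszMeasure_compl_eq_zero hK fun f hf => (hz f hf).1
  have hN := rieszMeasure_compl_eq_zero hK fun f hf => (hz f hf).2
  have fP := hfin P hP
  have fN := hfin N hN
  refine ⟨NNRealRMK.rieszMeasure P, NNRealRMK.rieszMeasure N,
    ⟨fP, inferInstance, hP⟩, ⟨fN, inferInstance, hN⟩, fun f => ?_⟩
  obtain ⟨χ, h1, -, hχ, -⟩ := exists_continuous_one_zero_of_isCompact hK isClosed_empty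
    (Set.disjoint_empty _)
  let g : C_c(X, ℝ) := ⟨⟨fun x => χ x * f x, by fun_prop⟩, hχ.mul_right⟩
  have hg : ∀ x ∈ K, f x = nnrealPart g x - nnrealPart (-g) x := by
    intro x hx
    have : g x = f x := by
      change χ x * f x = f x
      rw [h1 hx]; simp
    rw [← this, nnrealPart_apply, nnrealPart_apply]
    have h2 : (-g) x = - g x := rfl
    rw [h2, Real.coe_toNNReal', Real.coe_toNNReal', max_zero_sub_eq_self]
  have hint : ∀ Q : C_c(X, ℝ≥0) →ₗ[ℝ≥0] ℝ≥0, NNRealRMK.rieszMeasure Q Kᶜ = 0 →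
      IsFiniteMeasure (NNRealRMK.rieszMeasure Q) →
      ∫ x, f x ∂NNRealRMK.rieszMeasure Q = Q (nnrealPart g) - Q (nnrealPart (-g)) := by
    intro Q hQ _
    have hae : ∀ᵐ x ∂NNRealRMK.rieszMeasure Q, x ∈ K := by rw [ae_iff]; exact hQ
    rw [← NNRealRMK.integral_rieszMeasure, ← NNRealRMK.integral_rieszMeasure, ← integral_sub]
    · refine integral_congr_ae ?_
      filter_upwards [hae] with x hx using hg x hx
    · exact integrable_of_compact hK hQ (by fun_prop)
    · exact integrable_of_compact hK hQ (by fun_prop)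
  rw [hint P hP fP, hint N hN fN]
  have h3 : L f = L' (nnrealPart g).toReal - L' (nnrealPart (-g)).toReal := by
    rw [← sub_eq_zero, ← L'.map_sub]
    change L f - L _ = 0
    rw [← L.map_sub]
    refine hL0 _ fun x hx => ?_
    change f x - ((nnrealPart g).toReal x - (nnrealPart (-g)).toReal x) = 0
    rw [toReal_apply, toReal_apply, hg x hx, sub_self]
  rw [h3, hPN, hPN]
  ring

/-- **Riesz representation**: every continuous functional on `C(X, ℂ)` is integration against a
compactly supported regular complex measure. -/
theorem exists_pairing_eq (ℓ : C(X, ℂ) →L[ℂ] ℂ) :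
    ∃ μ : compactMeasures X, ∀ f : C(X, ℂ), pairing μ.1 f = ℓ f := by
  obtain ⟨K, hK, C, hℓ⟩ := exists_isCompact_norm_apply_le ℓ
  let c : C(X, ℝ) → C(X, ℂ) := fun f => ⟨fun x => (f x : ℂ), by fun_prop⟩
  have hc_add : ∀ f g, c (f + g) = c f + c g := fun f g => by ext x; simp [c]
  have hc_smul : ∀ (a : ℝ) f, c (a • f) = (a : ℂ) • c f := fun a f => by ext x; simp [c]
  have hbound : ∀ (f : C(X, ℝ)) (r : ℝ), 0 ≤ r → (∀ x ∈ K, |f x| ≤ r) → ‖ℓ (c f)‖ ≤ C * r :=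
    fun f r hr hf => hℓ (c f) r hr fun x hx => by simpa [c] using hf x hx
  let L₁ : C(X, ℝ) →ₗ[ℝ] ℝ :=
    { toFun := fun f => (ℓ (c f)).re
      map_add' := fun f g => by simp [hc_add]
      map_smul' := fun a f => by simp [hc_smul] }
  let L₂ : C(X, ℝ) →ₗ[ℝ] ℝ :=
    { toFun := fun f => (ℓ (c f)).im
      map_add' := fun f g => by simp [hc_add]
      map_smul' := fun a f => by simp [hc_smul] }
  obtain ⟨ρ₁, σ₁, ⟨hρ₁, hρ₁r, hρ₁K⟩, ⟨hσ₁, hσ₁r, hσ₁K⟩, h₁⟩ := exists_measure_sub_measure L₁ hK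
    fun f r hr hf => (Complex.abs_re_le_norm _).trans (hbound f r hr hf)
  obtain ⟨ρ₂, σ₂, ⟨hρ₂, hρ₂r, hρ₂K⟩, ⟨hσ₂, hσ₂r, hσ₂K⟩, h₂⟩ := exists_measure_sub_measure L₂ hK
    fun f r hr hf => (Complex.abs_im_le_norm _).trans (hbound f r hr hf)
  have r₁ := isCompactRadon_of_measure ρ₁ hK hρ₁K
  have r₂ := isCompactRadon_of_measure σ₁ hK hσ₁K
  have r₃ := isCompactRadon_of_measure ρ₂ hK hρ₂K
  have r₄ := isCompactRadon_of_measure σ₂ hK hσ₂K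
  have hr := (r₁.add (r₂.smul (-1))).add ((r₃.add (r₄.smul (-1))).smul Complex.I)
  have hreal : ∀ f : C(X, ℝ), pairing (⟨_, hr⟩ : compactMeasures X).1 (c f) = ℓ (c f) := by
    intro f
    have hi : ∀ {ρ : Measure X}, IsFiniteMeasure ρ → ρ Kᶜ = 0 → Integrable (c f) ρ :=
      fun _ h0 => integrable_of_compact hK h0 (c f).continuous
    have hint : ∀ ρ : Measure X, ∫ x, c f x ∂ρ = ((∫ x, f x ∂ρ : ℝ) : ℂ) := fun ρ =>
      integral_ofReal
    refine (pairing_add (r₁.add (r₂.smul (-1))) ((r₃.add (r₄.smul (-1))).smul Complex.I)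
        (c f).continuous).trans ?_
    rw [pairing_add r₁ (r₂.smul (-1)) (c f).continuous,
      pairing_smul _ ((r₃.add (r₄.smul (-1))).integrable (c f).continuous),
      pairing_add r₃ (r₄.smul (-1)) (c f).continuous,
      pairing_smul _ (r₂.integrable (c f).continuous),
      pairing_smul _ (r₄.integrable (c f).continuous),
      pairing_of_measure ρ₁ (hi hρ₁ hρ₁K), pairing_of_measure σ₁ (hi hσ₁ hσ₁K),
      pairing_of_measure ρ₂ (hi hρ₂ hρ₂K), pairing_of_measure σ₂ (hi hσ₂ hσ₂K),
      hint, hint, hint, hint]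
    have h₁' : (ℓ (c f)).re = _ := h₁ f
    have h₂' : (ℓ (c f)).im = _ := h₂ f
    apply Complex.ext
    · rw [h₁']; simp [sub_eq_add_neg]
    · rw [h₂']; simp [sub_eq_add_neg]
  refine ⟨⟨_, hr⟩, fun f => ?_⟩
  let u : C(X, ℝ) := ⟨fun x => (f x).re, by fun_prop⟩
  let v : C(X, ℝ) := ⟨fun x => (f x).im, by fun_prop⟩
  have hf : f = c u + Complex.I • c v := by
    ext x
    simp [c, u, v, mul_comm Complex.I, Complex.re_add_im]
  have hcoe : (⇑f : X → ℂ) = fun x => c u x + Complex.I * c v x := by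
    conv_lhs => rw [hf]
    rfl
  rw [hcoe, pairing_add_right hr (c u).continuous (by fun_prop), pairing_smul_right, hreal, hreal]
  conv_rhs => rw [hf, map_add, map_smul, smul_eq_mul]

end Riesz

/-! ### Separation of closed subspaces -/

/-- A point outside a closed complex subspace of a locally convex space is separated from it by a
continuous functional that vanishes on the subspace. -/
theorem exists_eq_zero_of_notMem_isClosed {E : Type*} [AddCommGroup E] [Module ℂ E]
    [TopologicalSpace E] [IsTopologicalAddGroup E] [ContinuousSMul ℂ E] [Module ℝ E]
    [IsScalarTower ℝ ℂ E] [LocallyConvexSpace ℝ E] {S : Submodule ℂ E}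
    (hS : IsClosed (S : Set E)) {x : E} (hx : x ∉ S) :
    ∃ ℓ : E →L[ℂ] ℂ, (∀ y ∈ S, ℓ y = 0) ∧ ℓ x ≠ 0 := by
  have hconv : Convex ℝ (S : Set E) := (S.restrictScalars ℝ).convex
  obtain ⟨ℓ, u, hu, hxu⟩ := RCLike.geometric_hahn_banach_closed_point (𝕜 := ℂ) hconv hS hx
  have h0 : 0 < u := by simpa using hu 0 S.zero_mem
  refine ⟨ℓ, fun y hy => ?_, fun h => ?_⟩
  · -- A nonzero value could be scaled to have real part `u`.
    by_contra hne
    have := hu (((u : ℂ) / ℓ y) • y) (S.smul_mem _ hy)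
    rw [map_smul, smul_eq_mul, div_mul_cancel₀ _ hne] at this
    simp at this
  · rw [h] at hxu
    simp at hxu
    linarith

/-- A point outside a closed subspace for the weak topology of a family of functionals is separated
from it by a linear combination of members of the family. -/
theorem exists_mem_span_of_notMem_isClosed {ι E : Type*} [AddCommGroup E] [Module ℂ E]
    (p : ι → E →ₗ[ℂ] ℂ) {S : Submodule ℂ E}
    (hS : IsClosed[⨅ i, .induced (p i) inferInstance] (S : Set E)) {x : E} (hx : x ∉ S) :
    ∃ ℓ ∈ Submodule.span ℂ (Set.range p), (∀ y ∈ S, ℓ y = 0) ∧ ℓ x ≠ 0 := by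
  let t : TopologicalSpace E := ⨅ i, .induced (p i) inferInstance
  have : IsTopologicalAddGroup E := topologicalAddGroup_iInf fun _ => topologicalAddGroup_induced _
  have : ContinuousSMul ℂ E := continuousSMul_iInf fun _ => continuousSMul_induced _
  let : Module ℝ E := Module.complexToReal E
  have : LocallyConvexSpace ℝ E := LocallyConvexSpace.iInf fun i =>
    LocallyConvexSpace.induced ((p i).restrictScalars ℝ)
  obtain ⟨ℓ, h0, h1⟩ := exists_eq_zero_of_notMem_isClosed hS hx
  exact ⟨ℓ, (LinearMap.mem_span_iff_continuous (ℓ : E →ₗ[ℂ] ℂ)).mpr ℓ.continuous, h0, h1⟩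

section

variable {X : Type*} [TopologicalSpace X] [T2Space X] [MeasurableSpace X] [BorelSpace X]

/-- The pairing of measures with continuous functions as a bilinear map. -/
def pairingLinear : C(X, ℂ) →ₗ[ℂ] compactMeasures X →ₗ[ℂ] ℂ :=
  LinearMap.mk₂ ℂ (fun f (μ : compactMeasures X) => pairing μ.1 f)
    (fun f g μ => pairing_add_right μ.2 f.continuous g.continuous)
    (fun c f μ => pairing_smul_right μ.1 c f)
    (fun f μ ν => pairing_add μ.2 ν.2 f.continuous)
    (fun c f μ => pairing_smul c (μ.2.integrable f.continuous))

theorem weakStarTopology_eq :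
    weakStarTopology X = ⨅ f : C(X, ℂ), .induced (pairingLinear f) inferInstance := by
  rw [weakStarTopology, Pi.topologicalSpace, induced_iInf]
  simp only [induced_compose]
  rfl

theorem continuous_pairing_left (f : C(X, ℂ)) :
    Continuous fun μ : compactMeasures X => pairing μ.1 f := by
  rw [show (fun μ : compactMeasures X => pairing μ.1 f) =
    (fun φ : C(X, ℂ) → ℂ => φ f) ∘ fun μ g => pairing μ.1 g from rfl]
  exact (continuous_apply f).comp continuous_induced_dom

theorem continuous_iff_pairing {Y : Type*} [TopologicalSpace Y] {F : Y → compactMeasures X} :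
    Continuous F ↔ ∀ f : C(X, ℂ), Continuous fun y => pairing (F y).1 f :=
  continuous_induced_rng.trans continuous_pi_iff

theorem exists_eq_pairing_of_mem_span {ℓ : compactMeasures X →ₗ[ℂ] ℂ}
    (hℓ : ℓ ∈ Submodule.span ℂ (Set.range (pairingLinear (X := X)))) :
    ∃ f : C(X, ℂ), ∀ μ, ℓ μ = pairing μ.1 f := by
  rw [← LinearMap.coe_range, Submodule.span_eq] at hℓ
  obtain ⟨f, rfl⟩ := hℓ
  exact ⟨f, fun μ => rfl⟩

/-- The dual of the space of measures with the weak-* topology is `C(X, ℂ)`. -/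
theorem exists_eq_pairing_of_continuous (ℓ : compactMeasures X →ₗ[ℂ] ℂ) (hℓ : Continuous ℓ) :
    ∃ f : C(X, ℂ), ∀ μ, ℓ μ = pairing μ.1 f := by
  rw [weakStarTopology_eq] at hℓ
  exact exists_eq_pairing_of_mem_span
    ((LinearMap.mem_span_iff_continuous (𝕜 := ℂ) (E := compactMeasures X) ℓ).mpr hℓ)

/-- A weak-* closed subspace of measures is separated from the other measures by continuous
functions. -/
theorem exists_pairing_ne_zero {J : Submodule ℂ (compactMeasures X)}
    (hJ : IsClosed (J : Set (compactMeasures X))) {μ : compactMeasures X} (hμ : μ ∉ J) :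
    ∃ f : C(X, ℂ), (∀ ν ∈ J, pairing ν.1 f = 0) ∧ pairing μ.1 f ≠ 0 := by
  have key := exists_mem_span_of_notMem_isClosed (E := compactMeasures X)
    (pairingLinear (X := X)) (S := J) (x := μ)
  rw [← weakStarTopology_eq] at key
  obtain ⟨ℓ, hℓ, h0, h1⟩ := key hJ hμ
  obtain ⟨f, hf⟩ := exists_eq_pairing_of_mem_span hℓ
  exact ⟨f, fun ν hν => (hf ν).symm.trans (h0 ν hν), fun h => h1 ((hf μ).trans h)⟩

end

section

/-! ### Densities and point masses -/

section

variable {X : Type*} [TopologicalSpace X] [LocallyCompactSpace X] [T2Space X] [MeasurableSpace X]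
  [BorelSpace X]

/-- Integration against a measure as a continuous functional. -/
def pairingCLM (μ : compactMeasures X) : C(X, ℂ) →L[ℂ] ℂ where
  toFun f := pairing μ.1 f
  map_add' f g := pairing_add_right μ.2 f.continuous g.continuous
  map_smul' c f := pairing_smul_right μ.1 c f
  cont := continuous_pairing μ.2

/-- The measure `p μ` with density `p` with respect to `μ`. -/
def mulMeasure (p : C(X, ℂ)) (μ : compactMeasures X) : compactMeasures X :=
  (exists_pairing_eq ((pairingCLM μ).comp
    ⟨LinearMap.mulLeft ℂ p, continuous_const.mul continuous_id⟩)).choose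

theorem pairing_mulMeasure (p : C(X, ℂ)) (μ : compactMeasures X) (f : C(X, ℂ)) :
    pairing (mulMeasure p μ).1 f = pairing μ.1 (p * f : C(X, ℂ)) :=
  (exists_pairing_eq ((pairingCLM μ).comp
    ⟨LinearMap.mulLeft ℂ p, continuous_const.mul continuous_id⟩)).choose_spec f

theorem continuous_mulMeasure (p : C(X, ℂ)) : Continuous (mulMeasure p) :=
  continuous_iff_pairing.mpr fun f => by
    simp only [pairing_mulMeasure]
    exact continuous_pairing_left _

/-- The unit mass at a point. -/
def pointMass (x : X) : compactMeasures X :=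
  (exists_pairing_eq (ContinuousMap.evalCLM ℂ x : C(X, ℂ) →L[ℂ] ℂ)).choose

theorem pairing_pointMass (x : X) (f : C(X, ℂ)) : pairing (pointMass x).1 f = f x :=
  (exists_pairing_eq (ContinuousMap.evalCLM ℂ x : C(X, ℂ) →L[ℂ] ℂ)).choose_spec f

end

variable {G : Type*} [AddCommGroup G] [TopologicalSpace G]

/-- An exponential as a continuous function. -/
def Exponential.toContinuousMap (m : Exponential G) : C(G, ℂ) := ⟨m.1, m.2⟩

theorem Exponential.toContinuousMap_apply (m : Exponential G) (x : G) :
    m.toContinuousMap x = m.1 x := rfl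

variable [IsTopologicalAddGroup G]

/-! ### Translations and reflections -/

/-- Translation of functions by `y`. -/
def translate (y : G) : C(G, ℂ) →ₗ[ℂ] C(G, ℂ) where
  toFun f := f.comp ⟨fun x => x + y, by fun_prop⟩
  map_add' _ _ := rfl
  map_smul' _ _ := rfl

theorem translate_apply (y : G) (f : C(G, ℂ)) (x : G) : translate y f x = f (x + y) := rfl

/-- The reflection `x ↦ f (-x)` of a function. -/
def reflect : C(G, ℂ) →L[ℂ] C(G, ℂ) where
  toFun f := f.comp ⟨fun x => -x, by fun_prop⟩
  map_add' _ _ := rfl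
  map_smul' _ _ := rfl
  cont := ContinuousMap.continuous_precomp _

theorem reflect_apply (f : C(G, ℂ)) (x : G) : reflect f x = f (-x) := rfl

theorem reflect_reflect (f : C(G, ℂ)) : reflect (reflect f) = f := by
  ext x; simp [reflect_apply]

variable [LocallyCompactSpace G] [T2Space G] [MeasurableSpace G] [BorelSpace G]

/-! ### Evaluation on the Fourier algebra -/

namespace FourierAlgebra

theorem ext {φ ψ : FourierAlgebra G} (h : ∀ m, φ.eval m = ψ.eval m) : φ = ψ :=
  Subtype.ext (funext h)

theorem eval_mul (φ ψ : FourierAlgebra G) (m : Exponential G) :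
    (φ * ψ).eval m = φ.eval m * ψ.eval m := rfl

theorem eval_add (φ ψ : FourierAlgebra G) (m : Exponential G) :
    (φ + ψ).eval m = φ.eval m + ψ.eval m := rfl

theorem eval_smul (c : ℂ) (φ : FourierAlgebra G) (m : Exponential G) :
    (c • φ).eval m = c * φ.eval m := rfl

/-- Evaluation at an exponential as a linear functional. -/
def evalLinear (m : Exponential G) : FourierAlgebra G →ₗ[ℂ] ℂ where
  toFun φ := φ.eval m
  map_add' _ _ := rfl
  map_smul' _ _ := rfl

end FourierAlgebra

open FourierAlgebra

variable (G) in
/-- The transform `μ ↦ μ̂` as a linear map. -/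
def transformLinear : compactMeasures G →ₗ[ℂ] FourierAlgebra G where
  toFun := transform
  map_add' μ ν := Subtype.ext ((fourierLinear G).map_add μ ν)
  map_smul' c μ := Subtype.ext ((fourierLinear G).map_smul c μ)

theorem transform_surjective : Function.Surjective (transform (G := G)) := by
  rintro ⟨_, μ, rfl⟩
  exact ⟨μ, rfl⟩

theorem continuous_transform : Continuous (transform (G := G)) := continuous_coinduced_rng

theorem eval_transform (μ : compactMeasures G) (m : Exponential G) :
    (transform μ).eval m = pairing μ.1 (reflect m.toContinuousMap) := rfl

theorem eval_transform_pointMass (x : G) (m : Exponential G) :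
    (transform (pointMass x)).eval m = m.1 (-x) := by
  rw [eval_transform, pairing_pointMass]; rfl

theorem transform_pointMass_add (x y : G) :
    transform (pointMass (x + y)) = transform (pointMass x) * transform (pointMass y) := by
  refine FourierAlgebra.ext fun m => ?_
  rw [eval_mul, eval_transform_pointMass, eval_transform_pointMass, eval_transform_pointMass,
    neg_add, AddChar.map_add_eq_mul]

/-- A function is annihilated by convolution with the measures of an ideal if and only if its
reflection is orthogonal to them: the ideal is stable under translation of measures, which is
multiplication by the transform of a point mass. -/
theorem mem_annihilator_iff {I : Ideal (FourierAlgebra G)} {f : C(G, ℂ)} :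
    f ∈ annihilator {μ | transform μ ∈ I} ↔
      ∀ μ : compactMeasures G, transform μ ∈ I → pairing μ.1 (reflect f) = 0 := by
  rw [mem_annihilator]
  refine ⟨fun h μ hμ => ?_, fun h μ hμ x => ?_⟩
  · have := h μ hμ 0
    unfold convolve at this
    simp only [zero_sub] at this
    exact this
  · let s : C(G, ℂ) →L[ℂ] C(G, ℂ) :=
      { toFun := fun g => g.comp ⟨fun y => -x + y, by fun_prop⟩
        map_add' := fun _ _ => rfl
        map_smul' := fun _ _ => rfl
        cont := ContinuousMap.continuous_precomp _ }
    obtain ⟨ν, hν⟩ := exists_pairing_eq ((pairingCLM μ).comp s)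
    have htr : transform ν = transform (pointMass (-x)) * transform μ := by
      refine FourierAlgebra.ext fun m => ?_
      rw [eval_mul, eval_transform, eval_transform_pointMass, hν, eval_transform, neg_neg]
      refine Eq.trans ?_ (pairing_smul_right μ.1 (m.1 x) _)
      refine congrArg (pairing μ.1) (funext fun y => ?_)
      change m.1 (-(-x + y)) = m.1 x * m.1 (-y)
      rw [neg_add, neg_neg, AddChar.map_add_eq_mul]
    have hmem : transform ν ∈ I := by
      rw [htr]; exact I.mul_mem_left _ hμ
    have h0 := h ν hmem
    rw [hν] at h0
    refine Eq.trans (congrArg (pairing μ.1) (funext fun y => ?_)) h0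
    change f (x - y) = f (-(-x + y))
    congr 1; abel

/-! ### Functionals of polynomial derivations -/

/-- A functional on the Fourier algebra is representable if it is integration of measures against
a continuous function. -/
def IsRepresentable (ℓ : FourierAlgebra G →ₗ[ℂ] ℂ) : Prop :=
  ∃ f : C(G, ℂ), ∀ μ, ℓ (transform μ) = pairing μ.1 f

theorem IsRepresentable.continuous {ℓ : FourierAlgebra G →ₗ[ℂ] ℂ} (h : IsRepresentable ℓ) :
    Continuous ℓ := by
  obtain ⟨f, hf⟩ := h
  refine continuous_coinduced_dom.mpr ?_
  rw [show ⇑ℓ ∘ transform = fun μ => pairing μ.1 f from funext hf]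
  exact continuous_pairing_left f

theorem isRepresentable_of_continuous {ℓ : FourierAlgebra G →ₗ[ℂ] ℂ} (h : Continuous ℓ) :
    IsRepresentable ℓ :=
  exists_eq_pairing_of_continuous (ℓ ∘ₗ transformLinear G) (h.comp continuous_transform)

theorem isRepresentable_evalLinear (m : Exponential G) : IsRepresentable (evalLinear m) :=
  ⟨_, fun μ => eval_transform μ m⟩

theorem IsRepresentable.comp {D : Module.End ℂ (FourierAlgebra G)}
    (hD : D ∈ polynomialDerivations G) {ℓ : FourierAlgebra G →ₗ[ℂ] ℂ} (hℓ : IsRepresentable ℓ) :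
    IsRepresentable (ℓ ∘ₗ D) := by
  refine Algebra.adjoin_induction (p := fun D _ => ∀ ℓ : FourierAlgebra G →ₗ[ℂ] ℂ,
    IsRepresentable ℓ → IsRepresentable (ℓ ∘ₗ D)) ?_ ?_ ?_ ?_ hD ℓ hℓ
  · intro D hD ℓ hℓ
    exact isRepresentable_of_continuous (hℓ.continuous.comp hD.continuous)
  · rintro c ℓ ⟨f, hf⟩
    refine ⟨c • f, fun μ => ?_⟩
    refine (ℓ.map_smul c _).trans ?_
    refine (congrArg (c • ·) (hf μ)).trans ?_
    exact (pairing_smul_right μ.1 c f).symm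
  · intro D E _ _ hD hE ℓ hℓ
    obtain ⟨f, hf⟩ := hD ℓ hℓ
    obtain ⟨g, hg⟩ := hE ℓ hℓ
    refine ⟨f + g, fun μ => ?_⟩
    refine (ℓ.map_add _ _).trans ?_
    refine (congrArg₂ (· + ·) (hf μ) (hg μ)).trans ?_
    exact (pairing_add_right μ.2 f.continuous g.continuous).symm
  · intro D E _ _ hD hE ℓ hℓ
    exact hE _ (hD ℓ hℓ)

/-- Iterated Leibniz rule: a polynomial derivation of a product is a finite sum of products of
operators applied to the factors. -/
theorem exists_apply_mul_eq_sum {D : Module.End ℂ (FourierAlgebra G)}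
    (hD : D ∈ polynomialDerivations G) :
    ∃ (ι : Type) (_ : Fintype ι) (P Q : ι → Module.End ℂ (FourierAlgebra G)),
      (∀ i, P i ∈ polynomialDerivations G) ∧ ∀ a b, D (a * b) = ∑ i, P i a * Q i b := by
  refine Algebra.adjoin_induction ?_ ?_ ?_ ?_ hD
  · intro D hD
    refine ⟨Bool, inferInstance, fun i => if i then D else 1, fun i => if i then 1 else D,
      ?_, fun a b => ?_⟩
    · rintro (_ | _)
      · exact one_mem _
      · exact Algebra.subset_adjoin hD
    · rw [Fintype.sum_bool]
      exact hD.leibniz a b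
  · intro c
    refine ⟨Unit, inferInstance, fun _ => c • 1, fun _ => 1,
      fun _ => Subalgebra.smul_mem _ (one_mem _) c, fun a b => ?_⟩
    rw [Fintype.sum_unique]
    exact (smul_mul_assoc c a b).symm
  · rintro D E _ _ ⟨ι, _, P, Q, hP, h⟩ ⟨κ, _, R, S, hR, h'⟩
    refine ⟨ι ⊕ κ, inferInstance, Sum.elim P R, Sum.elim Q S, ?_, fun a b => ?_⟩
    · rintro (i | i)
      exacts [hP i, hR i]
    · rw [LinearMap.add_apply, h, h', Fintype.sum_sum_type]
      rfl
  · rintro D E _ _ ⟨ι, _, P, Q, hP, h⟩ ⟨κ, _, R, S, hR, h'⟩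
    refine ⟨κ × ι, inferInstance, fun i => P i.2 * R i.1, fun i => Q i.2 * S i.1,
      fun i => mul_mem (hP _) (hR _), fun a b => ?_⟩
    rw [Module.End.mul_apply, h', map_sum, Fintype.sum_prod_type]
    exact Finset.sum_congr rfl fun j _ => h _ _

/-- The functional `μ ↦ D(μ̂)(m)` of a polynomial derivation `D` is integration against a continuous
function whose translates span a finite dimensional space. -/
theorem exists_translate_mem_finiteDimensional {D : Module.End ℂ (FourierAlgebra G)}
    (hD : D ∈ polynomialDerivations G) (m : Exponential G) :
    ∃ f : C(G, ℂ), (∀ μ, (D (transform μ)).eval m = pairing μ.1 (reflect f)) ∧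
      ∃ F : Submodule ℂ C(G, ℂ), FiniteDimensional ℂ F ∧ ∀ y, translate y f ∈ F := by
  have hrep : ∀ E ∈ polynomialDerivations G, ∃ f : C(G, ℂ),
      ∀ μ, (E (transform μ)).eval m = pairing μ.1 (reflect f) := by
    intro E hE
    obtain ⟨g, hg⟩ := IsRepresentable.comp hE (isRepresentable_evalLinear m)
    exact ⟨reflect g, by rw [reflect_reflect]; exact hg⟩
  have hval : ∀ {E : Module.End ℂ (FourierAlgebra G)} {f : C(G, ℂ)},
      (∀ μ, (E (transform μ)).eval m = pairing μ.1 (reflect f)) →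
      ∀ x, f x = (E (transform (pointMass (-x)))).eval m := by
    intro E f hf x
    rw [hf, pairing_pointMass, reflect_apply, neg_neg]
  obtain ⟨f, hf⟩ := hrep D hD
  obtain ⟨ι, _, P, Q, hP, h⟩ := exists_apply_mul_eq_sum hD
  choose g hg using fun i => hrep (P i) (hP i)
  refine ⟨f, hf, Submodule.span ℂ (Set.range g), FiniteDimensional.span_of_finite ℂ
    (Set.finite_range g), fun y => ?_⟩
  have : translate y f =
      ∑ i, (evalLinear m (Q i (transform (pointMass (-y))))) • g i := by
    ext x
    rw [translate_apply, hval hf, neg_add, transform_pointMass_add, h]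
    change evalLinear m _ = _
    rw [map_sum, ContinuousMap.sum_apply]
    refine Finset.sum_congr rfl fun i _ => ?_
    rw [ContinuousMap.smul_apply, hval (hg i), smul_eq_mul, mul_comm]
    rfl
  rw [this]
  exact Submodule.sum_mem _ fun i _ => Submodule.smul_mem _ _ (Submodule.subset_span ⟨i, rfl⟩)

end

section

open FourierAlgebra

variable {G : Type*} [AddCommGroup G] [TopologicalSpace G]

/-! ### Derivations given by additive functions -/

variable (G) in
/-- The continuous additive functions on `G`. -/
def additiveFunctions : Set C(G, ℂ) := {a | ∀ x y, a (x + y) = a x + a y}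

/-- The exponential `x ↦ m x * exp (t * a x)`, for an additive function `a`. -/
def Exponential.twist (m : Exponential G) {a : C(G, ℂ)} (ha : a ∈ additiveFunctions G) (t : ℂ) :
    Exponential G :=
  ⟨{ toFun := fun x => m.1 x * Complex.exp (t * a x)
     map_zero_eq_one' := by
      have h : a 0 = 0 := by simpa using ha 0 0
      simp [h]
     map_add_eq_mul' := fun x y => by
      rw [ha, mul_add, Complex.exp_add, AddChar.map_add_eq_mul]
      ring },
    m.2.mul (by fun_prop)⟩

theorem Exponential.twist_apply (m : Exponential G) {a : C(G, ℂ)} (ha : a ∈ additiveFunctions G)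
    (t : ℂ) (x : G) : (m.twist ha t).1 x = m.1 x * Complex.exp (t * a x) := rfl

theorem Exponential.twist_zero (m : Exponential G) {a : C(G, ℂ)} (ha : a ∈ additiveFunctions G) :
    m.twist ha 0 = m := by
  refine Subtype.ext (DFunLike.ext _ _ fun x => ?_)
  rw [Exponential.twist_apply, zero_mul, Complex.exp_zero, mul_one]

variable [IsTopologicalAddGroup G] [LocallyCompactSpace G] [T2Space G] [MeasurableSpace G]
  [BorelSpace G]

/-- Multiplication of measures by an additive function `a` is, on the side of transforms, the
derivative along the one-parameter families `m * exp (t * a)` of exponentials, up to sign. -/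
theorem hasDerivAt_eval_twist {a : C(G, ℂ)} (ha : a ∈ additiveFunctions G) (φ : FourierAlgebra G)
    {μ : compactMeasures G} (hμ : transform μ = φ) (m : Exponential G) :
    HasDerivAt (fun t => φ.eval (m.twist ha t)) (-(transform (mulMeasure a μ)).eval m) 0 := by
  subst hμ
  -- The difference quotients are integrals of a family `F t` of functions that is continuous in
  -- `t`, since `(exp z - 1) / z` extends continuously to `z = 0`.
  have hE : Continuous (dslope Complex.exp 0) := by
    rw [continuous_iff_continuousAt]
    intro z
    rcases eq_or_ne z 0 with rfl | hz
    · exact continuousAt_dslope_same.mpr Complex.differentiable_exp.differentiableAt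
    · exact (continuousAt_dslope_of_ne hz).mpr Complex.continuous_exp.continuousAt
  let F : C(ℂ, C(G, ℂ)) := ContinuousMap.curry
    ⟨fun p : ℂ × G => m.1 (-p.2) * (a (-p.2) * dslope Complex.exp 0 (p.1 * a (-p.2))),
      (m.continuous_neg.comp continuous_snd).mul
        (Continuous.mul (by fun_prop) (hE.comp (by fun_prop)))⟩
  have hF : ∀ t x, F t x = m.1 (-x) * (a (-x) * dslope Complex.exp 0 (t * a (-x))) :=
    fun _ _ => rfl
  have hneg : ∀ x, a (-x) = -a x := fun x => by
    have h := ha (-x) x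
    have h0 : a 0 = 0 := by simpa using ha 0 0
    rw [neg_add_cancel, h0] at h
    linear_combination -h
  have h0 : pairing μ.1 (F 0) = -(transform (mulMeasure a μ)).eval m := by
    rw [eval_transform, pairing_mulMeasure, ← neg_one_mul, ← pairing_smul_right]
    refine congrArg (pairing μ.1) (funext fun x => ?_)
    rw [hF, zero_mul, dslope_same, Complex.deriv_exp, Complex.exp_zero, hneg]
    change m.1 (-x) * (-a x * 1) = -1 * (a x * m.1 (-x))
    ring
  rw [hasDerivAt_iff_tendsto_slope, ← h0]
  have hcont : Continuous fun t => pairing μ.1 (F t) := (continuous_pairing μ.2).comp F.continuous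
  refine ((hcont.tendsto 0).mono_left nhdsWithin_le_nhds).congr' ?_
  filter_upwards [self_mem_nhdsWithin] with t ht
  rw [slope_def_field, Exponential.twist_zero, eval_transform, eval_transform, sub_zero,
    eq_div_iff ht, mul_comm, ← pairing_smul_right, eq_sub_iff_add_eq]
  rw [← pairing_add_right μ.2 (by fun_prop) (by fun_prop)]
  refine congrArg (pairing μ.1) (funext fun x => ?_)
  rw [hF, reflect_apply, reflect_apply, Exponential.toContinuousMap_apply,
    Exponential.toContinuousMap_apply, Exponential.twist_apply]
  have hs : t * a (-x) * dslope Complex.exp 0 (t * a (-x)) = Complex.exp (t * a (-x)) - 1 := by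
    simpa using sub_smul_dslope Complex.exp 0 (t * a (-x))
  linear_combination m.1 (-x) * hs

theorem transform_mulMeasure_congr {a : C(G, ℂ)} (ha : a ∈ additiveFunctions G)
    {μ ν : compactMeasures G} (h : transform μ = transform ν) :
    transform (mulMeasure a μ) = transform (mulMeasure a ν) := by
  refine FourierAlgebra.ext fun m => neg_injective ?_
  exact (hasDerivAt_eval_twist ha (transform ν) h m).unique
    (hasDerivAt_eval_twist ha (transform ν) rfl m)

/-- The operator `μ̂ ↦ (a μ)^` on the Fourier algebra, for an additive function `a`. -/
def additiveDerivation {a : C(G, ℂ)} (ha : a ∈ additiveFunctions G) :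
    Module.End ℂ (FourierAlgebra G) where
  toFun φ := transform (mulMeasure a (transform_surjective φ).choose)
  map_add' φ ψ := by
    refine FourierAlgebra.ext fun m => neg_injective ?_
    have h := fun φ : FourierAlgebra G =>
      hasDerivAt_eval_twist ha φ (transform_surjective φ).choose_spec m
    rw [eval_add, neg_add]
    exact (h (φ + ψ)).unique ((h φ).add (h ψ))
  map_smul' c φ := by
    refine FourierAlgebra.ext fun m => neg_injective ?_
    have h := fun φ : FourierAlgebra G =>
      hasDerivAt_eval_twist ha φ (transform_surjective φ).choose_spec m
    rw [RingHom.id_apply, eval_smul, ← mul_neg]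
    exact (h (c • φ)).unique ((h φ).const_mul c)

theorem additiveDerivation_transform {a : C(G, ℂ)} (ha : a ∈ additiveFunctions G)
    (μ : compactMeasures G) :
    additiveDerivation ha (transform μ) = transform (mulMeasure a μ) :=
  transform_mulMeasure_congr ha (transform_surjective (transform μ)).choose_spec

theorem hasDerivAt_additiveDerivation {a : C(G, ℂ)} (ha : a ∈ additiveFunctions G)
    (φ : FourierAlgebra G) (m : Exponential G) :
    HasDerivAt (fun t => φ.eval (m.twist ha t)) (-(additiveDerivation ha φ).eval m) 0 :=
  hasDerivAt_eval_twist ha φ (transform_surjective φ).choose_spec m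

theorem additiveDerivation_mem {a : C(G, ℂ)} (ha : a ∈ additiveFunctions G) :
    additiveDerivation ha ∈ polynomialDerivations G := by
  by_cases h0 : additiveDerivation ha = 0
  · rw [h0]; exact zero_mem _
  refine Algebra.subset_adjoin ⟨h0, ?_, fun φ ψ => ?_⟩
  · refine continuous_coinduced_dom.mpr ?_
    rw [show ⇑(additiveDerivation ha) ∘ transform = transform ∘ mulMeasure a from
      funext fun μ => additiveDerivation_transform ha μ]
    exact continuous_transform.comp (continuous_mulMeasure a)
  · refine FourierAlgebra.ext fun m => neg_injective ?_
    have h := (hasDerivAt_additiveDerivation ha φ m).mul (hasDerivAt_additiveDerivation ha ψ m)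
    refine (hasDerivAt_additiveDerivation ha (φ * ψ) m).unique (h.congr_deriv ?_)
    rw [Exponential.twist_zero, eval_add, eval_mul, eval_mul]
    ring

variable (G) in
/-- The polynomials in continuous additive functions, as a subalgebra of `C(G, ℂ)`. -/
def polynomialFunctions : Subalgebra ℂ C(G, ℂ) := Algebra.adjoin ℂ (additiveFunctions G)

/-- Multiplication of measures by a polynomial in additive functions is a polynomial derivation. -/
theorem exists_polynomialDerivation {p : C(G, ℂ)} (hp : p ∈ polynomialFunctions G) :
    ∃ D ∈ polynomialDerivations G, ∀ μ, D (transform μ) = transform (mulMeasure p μ) := by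
  refine Algebra.adjoin_induction ?_ ?_ ?_ ?_ hp
  · intro a ha
    exact ⟨additiveDerivation ha, additiveDerivation_mem ha, additiveDerivation_transform ha⟩
  · intro c
    refine ⟨c • 1, Subalgebra.smul_mem _ (one_mem _) c, fun μ => FourierAlgebra.ext fun m => ?_⟩
    rw [eval_transform, pairing_mulMeasure]
    exact (pairing_smul_right μ.1 c _).symm
  · rintro p q - - ⟨D, hD, h⟩ ⟨E, hE, h'⟩
    refine ⟨D + E, add_mem hD hE, fun μ => FourierAlgebra.ext fun m => ?_⟩
    rw [LinearMap.add_apply, eval_add, h, h', eval_transform, eval_transform, eval_transform,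
      pairing_mulMeasure, pairing_mulMeasure, pairing_mulMeasure, add_mul]
    exact (pairing_add_right μ.2 (ContinuousMap.continuous _) (ContinuousMap.continuous _)).symm
  · rintro p q - - ⟨D, hD, h⟩ ⟨E, hE, h'⟩
    refine ⟨D * E, mul_mem hD hE, fun μ => FourierAlgebra.ext fun m => ?_⟩
    rw [Module.End.mul_apply, h', h, eval_transform, eval_transform,
      pairing_mulMeasure, pairing_mulMeasure, pairing_mulMeasure, mul_comm p q, mul_assoc]

end

/-! ### Logarithms of commuting unipotent operators -/

section Nilpotent

open Polynomial

variable {A : Type*} [Ring A] [Algebra ℚ A]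

/-- The exponential of an element `a` with `a ^ k = 0` is a polynomial in `a`. -/
theorem exp_eq_aeval {a : A} {k : ℕ} (h : a ^ k = 0) :
    IsNilpotent.exp a = aeval a (∑ i ∈ Finset.range k, C (i.factorial : ℚ)⁻¹ * X ^ i) := by
  rw [IsNilpotent.exp_eq_sum h, map_sum]
  refine Finset.sum_congr rfl fun i _ => ?_
  rw [map_mul, aeval_C, map_pow, aeval_X, Algebra.smul_def]

theorem eq_zero_of_exp_eq_one {a : A} (ha : IsNilpotent a) (h : IsNilpotent.exp a = 1) : a = 0 := by
  obtain ⟨k, hk⟩ := ha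
  -- `exp a - 1` is `a` times a unit.
  have hk' : a ^ (k + 2) = 0 := by rw [pow_add, hk, zero_mul]
  rw [IsNilpotent.exp_eq_sum hk', Finset.sum_range_succ', Finset.sum_range_succ'] at h
  simp only [pow_succ _ (_ + 1), zero_add, pow_zero, pow_one, Nat.factorial_zero, Nat.factorial_one,
    Nat.cast_one, inv_one, one_smul, add_eq_right] at h
  have h2 : (∑ i ∈ Finset.range k, ((i + 1 + 1).factorial : ℚ)⁻¹ • (a ^ (i + 1))) * a + a
      = 0 := by
    rw [Finset.sum_mul]
    simp only [smul_mul_assoc]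
    exact h
  have hnil :
      IsNilpotent (∑ i ∈ Finset.range k, ((i + 1 + 1).factorial : ℚ)⁻¹ • (a ^ (i + 1))) := by
    have : ∑ i ∈ Finset.range k, ((i + 1 + 1).factorial : ℚ)⁻¹ • (a ^ (i + 1)) =
        (∑ i ∈ Finset.range k, ((i + 1 + 1).factorial : ℚ)⁻¹ • a ^ i) * a := by
      rw [Finset.sum_mul]
      simp only [smul_mul_assoc, pow_succ]
    rw [this]
    refine Commute.isNilpotent_mul_left ?_ ⟨k, hk⟩
    exact Commute.sum_left _ _ _ fun i _ => ((Commute.refl a).pow_left i).smul_left _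
  have hu := hnil.isUnit_add_one
  refine hu.mul_right_eq_zero.mp ?_
  rw [add_mul, one_mul]
  exact h2

theorem exp_injective_of_commute {a b : A} (ha : IsNilpotent a) (hb : IsNilpotent b)
    (hab : Commute a b) (h : IsNilpotent.exp a = IsNilpotent.exp b) : a = b := by
  have h1 : IsNilpotent.exp (a + -b) = 1 := by
    rw [IsNilpotent.exp_add_of_commute hab.neg_right ha hb.neg, h,
      IsNilpotent.exp_mul_exp_neg_self hb]
  rw [← sub_eq_zero, sub_eq_add_neg]
  exact eq_zero_of_exp_eq_one (hab.neg_right.isNilpotent_add ha hb.neg) h1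

/-- A logarithm: a polynomial `q` without constant term such that `exp (q n) = 1 + n` whenever
`n ^ k = 0`. It is built by successive approximation: `exp (-n) * (1 + n) = 1 + n ^ 2 * r n` for
some polynomial `r`, and the order of nilpotency of `n ^ 2 * r n` is smaller. -/
theorem exists_log_polynomial (k : ℕ) :
    ∃ q : ℚ[X], X ∣ q ∧ ∀ {A : Type*} [Ring A] [Algebra ℚ A] (n : A), n ^ (k + 1) = 0 →
      IsNilpotent.exp (aeval n q) = 1 + n := by
  induction k with
  | zero =>
    refine ⟨0, dvd_zero _, fun n hn => ?_⟩
    rw [zero_add, pow_one] at hn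
    simp [hn]
  | succ k ih =>
    obtain ⟨q, ⟨q', rfl⟩, hq⟩ := ih
    let s : ℚ[X] := ∑ i ∈ Finset.range k, C ((i + 1 + 1).factorial : ℚ)⁻¹ * X ^ i
    let r : ℚ[X] := -1 + s.comp (-X) * (1 + X)
    refine ⟨X + (X * q').comp (X ^ 2 * r), ?_, fun {A} _ _ n hn => ?_⟩
    · rw [mul_comp, X_comp]
      exact dvd_add dvd_rfl
        (dvd_mul_of_dvd_left (dvd_mul_of_dvd_left (dvd_pow_self X two_ne_zero) _) _)
    have hnil : IsNilpotent n := ⟨_, hn⟩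
    have hcomm : ∀ p q : ℚ[X], Commute (aeval n p) (aeval n q) := fun p q => by
      rw [Commute, SemiconjBy, ← map_mul, ← map_mul, mul_comm]
    have hexp : IsNilpotent.exp (-n) = aeval n (1 - X + X ^ 2 * s.comp (-X)) := by
      have hn' : (-n) ^ (k + 2) = 0 := by rw [neg_pow, hn, mul_zero]
      rw [exp_eq_aeval hn', Finset.sum_range_succ', Finset.sum_range_succ',
        show (-n) = aeval n (-X : ℚ[X]) by simp, ← aeval_comp]
      congr 1
      have hs : ∑ i ∈ Finset.range k, C ((i + 1 + 1).factorial : ℚ)⁻¹ * X ^ (i + 1 + 1) =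
          X ^ 2 * s := by
        rw [Finset.mul_sum]
        exact Finset.sum_congr rfl fun i _ => by ring
      rw [hs]
      simp
      ring
    have hN : IsNilpotent.exp (-n) * (1 + n) = 1 + aeval n (X ^ 2 * r) := by
      rw [hexp, show (1 : A) + n = aeval n (1 + X : ℚ[X]) by simp, ← map_mul,
        show (1 : A) = aeval n (1 : ℚ[X]) by simp, ← map_add]
      congr 1
      simp only [r]
      ring
    have hN0 : aeval n (X ^ 2 * r) ^ (k + 1) = 0 := by
      rw [← map_pow, mul_pow, ← pow_mul, show 2 * (k + 1) = k + 1 + 1 + k by ring, pow_add,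
        mul_assoc, map_mul, map_pow, aeval_X, hn, zero_mul]
    have hlog := hq _ hN0
    have hlog_nil : IsNilpotent (aeval (aeval n (X ^ 2 * r)) (X * q')) := by
      rw [map_mul, aeval_X, ← aeval_comp]
      exact (hcomm _ _).isNilpotent_mul_right ⟨_, hN0⟩
    rw [map_add, aeval_X, aeval_comp, IsNilpotent.exp_add_of_commute ?_ hnil hlog_nil, hlog, ← hN,
      ← mul_assoc, IsNilpotent.exp_mul_exp_neg_self hnil, one_mul]
    rw [← aeval_comp]
    have := hcomm X ((X * q').comp (X ^ 2 * r))
    rwa [aeval_X] at this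

theorem commute_aeval {x y : A} (h : Commute x y) (p : ℚ[X]) : Commute x (aeval y p) := by
  refine Polynomial.induction_on (motive := fun p => Commute x (aeval y p)) p ?_ ?_ ?_
  · intro c
    rw [aeval_C]
    exact (Algebra.commutes c x).symm
  · intro p q hp hq
    rw [map_add]
    exact hp.add_right hq
  · intro i c _
    rw [map_mul, aeval_C, map_pow, aeval_X]
    exact Commute.mul_right (Algebra.commutes c x).symm (h.pow_right _)

/-- Logarithm and exponential of unipotent elements of complex algebras as polynomials: they are
inverse to each other, and the logarithm turns products of commuting elements into sums. -/
theorem exists_log_exp_polynomial (k : ℕ) :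
    ∃ l e : ℂ[X], ∀ {A : Type*} [Ring A] [Algebra ℂ A],
      (∀ u : A, (u - 1) ^ (k + 1) = 0 → aeval (aeval (u - 1) l) e = u) ∧
      ∀ u v : A, Commute u v → (u - 1) ^ (k + 1) = 0 → (v - 1) ^ (k + 1) = 0 →
        (u * v - 1) ^ (k + 1) = 0 → aeval (u * v - 1) l = aeval (u - 1) l + aeval (v - 1) l := by
  obtain ⟨q, ⟨q', rfl⟩, hq⟩ := exists_log_polynomial k
  refine ⟨(X * q').map (algebraMap ℚ ℂ),
    (∑ i ∈ Finset.range (k + 1), C (i.factorial : ℚ)⁻¹ * X ^ i).map (algebraMap ℚ ℂ),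
    fun {A} _ _ => ?_⟩
  let : Algebra ℚ A := Algebra.compHom A (algebraMap ℚ ℂ)
  have : IsScalarTower ℚ ℂ A := IsScalarTower.of_algebraMap_eq fun _ => rfl
  simp only [aeval_map_algebraMap]
  have hnil : ∀ n : A, n ^ (k + 1) = 0 → aeval n (X * q') ^ (k + 1) = 0 := fun n hn => by
    rw [← map_pow, mul_pow, map_mul, map_pow, aeval_X, hn, zero_mul]
  refine ⟨fun u hu => ?_, fun u v huv hu hv huv' => ?_⟩
  · rw [← exp_eq_aeval (hnil _ hu), hq _ hu, add_sub_cancel]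
  · have h1 : Commute (u - 1) (v - 1) :=
      (huv.sub_left (Commute.one_left v)).sub_right (Commute.one_right _)
    have h2 : Commute (u * v - 1) (u - 1) :=
      (((Commute.refl u).mul_left huv.symm).sub_left (Commute.one_left u)).sub_right
        (Commute.one_right _)
    have h3 : Commute (u * v - 1) (v - 1) :=
      ((huv.mul_left (Commute.refl v)).sub_left (Commute.one_left v)).sub_right
        (Commute.one_right _)
    have haeval : ∀ {x y : A}, Commute x y → Commute (aeval x (X * q')) (aeval y (X * q')) :=
      fun h => (commute_aeval (commute_aeval h _).symm _).symm
    refine exp_injective_of_commute ⟨_, hnil _ huv'⟩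
      ((haeval h1).isNilpotent_add ⟨_, hnil _ hu⟩ ⟨_, hnil _ hv⟩)
      ((haeval h2).add_right (haeval h3)) ?_
    rw [IsNilpotent.exp_add_of_commute (haeval h1) ⟨_, hnil _ hu⟩ ⟨_, hnil _ hv⟩, hq _ huv',
      hq _ hu, hq _ hv]
    noncomm_ring

end Nilpotent

section

/-! ### Commuting operators on finite dimensional spaces -/

section FiniteDimensional

variable {E : Type*} [AddCommGroup E] [Module ℂ E] [FiniteDimensional ℂ E]

variable (E) in
/-- The operator valued functions on `G` all of whose matrix coefficients lie in an algebra `S` of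
functions. -/
def coefficientSubalgebra {G : Type*} (S : Subalgebra ℂ (G → ℂ)) :
    Subalgebra ℂ (G → Module.End ℂ E) where
  carrier := {B | ∀ (ℓ : E →ₗ[ℂ] ℂ) (e : E), (fun y => ℓ (B y e)) ∈ S}
  mul_mem' := fun {B C} hB hC ℓ e => by
    let b := Module.finBasis ℂ E
    have : (fun y => ℓ ((B * C) y e)) =
        ∑ i, (fun y => b.coord i (C y e)) * fun y => ℓ (B y (b i)) := by
      funext y
      rw [Finset.sum_apply, Pi.mul_apply, Module.End.mul_apply]
      conv_lhs => rw [← b.sum_repr (C y e), map_sum, map_sum]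
      refine Finset.sum_congr rfl fun i _ => ?_
      rw [map_smul, map_smul, smul_eq_mul]
      rfl
    rw [this]
    exact Subalgebra.sum_mem _ fun i _ => S.mul_mem (hC _ _) (hB _ _)
  add_mem' := fun {B C} hB hC ℓ e => by
    have : (fun y => ℓ ((B + C) y e)) = (fun y => ℓ (B y e)) + fun y => ℓ (C y e) := by
      funext y
      simp
    rw [this]
    exact S.add_mem (hB ℓ e) (hC ℓ e)
  algebraMap_mem' := fun c ℓ e => by
    have : (fun y => ℓ (algebraMap ℂ (G → Module.End ℂ E) c y e)) =
        algebraMap ℂ (G → ℂ) (c * ℓ e) := by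
      funext y
      simp [Pi.algebraMap_apply, Module.algebraMap_end_apply]
    rw [this]
    exact S.algebraMap_mem _

theorem aeval_mem_coefficientSubalgebra {G : Type*} {S : Subalgebra ℂ (G → ℂ)}
    {B : G → Module.End ℂ E} (hB : B ∈ coefficientSubalgebra E S) (p : Polynomial ℂ) :
    (fun y => Polynomial.aeval (B y) p) ∈ coefficientSubalgebra E S := by
  have : (fun y => Polynomial.aeval (B y) p) = Polynomial.aeval B p := by
    funext y
    exact Polynomial.aeval_algHom_apply (Pi.evalAlgHom ℂ (fun _ : G => Module.End ℂ E) y) B p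
  rw [this]
  exact Algebra.adjoin_le (Set.singleton_subset_iff.mpr hB)
    (Polynomial.aeval_mem_adjoin_singleton ℂ B)

/-- The matrix coefficients of a continuous unipotent representation are polynomials in continuous
additive functions: the logarithm of the representation is additive. -/
theorem exists_polynomialFunctions_of_unipotent {G : Type*} [AddCommGroup G] [TopologicalSpace G]
    {U : G → Module.End ℂ E} (hU : ∀ x y, U (x + y) = U x * U y) {k : ℕ}
    (hk : ∀ y, (U y - 1) ^ (k + 1) = 0)
    (hcont : ∀ (ℓ : E →ₗ[ℂ] ℂ) (e : E), Continuous fun y => ℓ (U y e)) (ℓ : E →ₗ[ℂ] ℂ) (e : E) :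
    ∃ p ∈ polynomialFunctions G, ∀ y, ℓ (U y e) = p y := by
  obtain ⟨l, ex, h⟩ := exists_log_exp_polynomial k
  obtain ⟨hexp, hlog⟩ := h (A := Module.End ℂ E)
  let L : G → Module.End ℂ E := fun y => Polynomial.aeval (U y - 1) l
  have hLadd : ∀ x y, L (x + y) = L x + L y := fun x y => by
    have hc : Commute (U x) (U y) := by
      rw [Commute, SemiconjBy, ← hU, ← hU, add_comm]
    have h3 := hk (x + y)
    simp only [L]
    rw [hU] at h3 ⊢
    exact hlog _ _ hc (hk x) (hk y) h3
  have hLcont : L ∈ coefficientSubalgebra E (continuousSubalgebra : Subalgebra ℂ (G → ℂ)) := by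
    refine aeval_mem_coefficientSubalgebra (B := U - 1) ?_ l
    exact Subalgebra.sub_mem _ hcont (one_mem _)
  have hLpoly : L ∈ coefficientSubalgebra E
      ((polynomialFunctions G).map (ContinuousMap.coeFnAlgHom ℂ)) := fun ℓ e => by
    refine ⟨⟨fun y => ℓ (L y e), hLcont ℓ e⟩, Algebra.subset_adjoin fun x y => ?_, rfl⟩
    change ℓ (L (x + y) e) = ℓ (L x e) + ℓ (L y e)
    rw [hLadd, LinearMap.add_apply, map_add]
  obtain ⟨p, hp, hpU⟩ := aeval_mem_coefficientSubalgebra hLpoly ex ℓ e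
  refine ⟨p, hp, fun y => ?_⟩
  rw [← hexp (U y) (hk y)]
  exact (congrFun hpU y).symm

/-- Commuting operators, each with a single eigenvalue, have a common eigenvector. -/
theorem exists_common_eigenvector {ι : Type*} [Nontrivial E] {T : ι → Module.End ℂ E} {χ : ι → ℂ}
    (hT : ∀ i j, Commute (T i) (T j)) (hχ : ∀ i, IsNilpotent (T i - χ i • 1)) :
    ∃ e ≠ 0, ∀ i, T i e = χ i • e := by
  -- Consider a minimal nonzero invariant subspace.
  obtain ⟨M, ⟨hM0, hM⟩, hmin⟩ := IsArtinian.set_has_minimal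
    {M : Submodule ℂ E | M ≠ ⊥ ∧ ∀ i, ∀ e ∈ M, T i e ∈ M}
    ⟨⊤, top_ne_bot, fun _ _ _ => Submodule.mem_top⟩
  obtain ⟨e, he, he0⟩ := M.exists_mem_ne_zero_of_ne_bot hM0
  refine ⟨e, he0, fun i => ?_⟩
  let N : Module.End ℂ E := T i - χ i • 1
  have hN : ∀ x, N x = T i x - χ i • x := fun x => rfl
  have hNM : ∀ n : ℕ, (N ^ n) e ∈ M := by
    intro n
    induction n with
    | zero => simpa using he
    | succ n ih =>
      rw [pow_succ', Module.End.mul_apply, hN]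
      exact M.sub_mem (hM i _ ih) (M.smul_mem _ ih)
  have hne : M ⊓ LinearMap.ker N ≠ ⊥ := by
    obtain ⟨k, hk⟩ := hχ i
    have hex : ∃ n, (N ^ n) e = 0 := ⟨k, by rw [show N ^ k = 0 from hk]; rfl⟩
    classical
    have hpos : Nat.find hex ≠ 0 := by
      rw [Ne, Nat.find_eq_zero]
      simpa using he0
    obtain ⟨n, hn⟩ := Nat.exists_eq_succ_of_ne_zero hpos
    refine (Submodule.ne_bot_iff _).mpr ⟨(N ^ n) e, ⟨hNM n, ?_⟩, Nat.find_min hex (by omega)⟩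
    rw [SetLike.mem_coe, LinearMap.mem_ker, ← Module.End.mul_apply, ← pow_succ']
    have := Nat.find_spec hex
    rwa [hn] at this
  have hinv : ∀ j, ∀ x ∈ M ⊓ LinearMap.ker N, T j x ∈ M ⊓ LinearMap.ker N := by
    rintro j x ⟨hx, hx'⟩
    rw [SetLike.mem_coe, LinearMap.mem_ker, hN, sub_eq_zero] at hx'
    refine ⟨hM j x hx, ?_⟩
    rw [SetLike.mem_coe, LinearMap.mem_ker, hN, sub_eq_zero, ← Module.End.mul_apply, hT i j,
      Module.End.mul_apply, hx', map_smul]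
  have heq : M ⊓ LinearMap.ker N = M :=
    eq_of_le_of_not_lt inf_le_left (hmin _ ⟨hne, hinv⟩)
  have hek : e ∈ LinearMap.ker N := (heq.symm ▸ he : e ∈ M ⊓ LinearMap.ker N).2
  rwa [LinearMap.mem_ker, hN, sub_eq_zero] at hek

end FiniteDimensional

section Invariant

variable {V : Type*} [AddCommGroup V] [Module ℂ V] {W : Submodule ℂ V}

theorem coe_restrict_sub_smul_pow {f : Module.End ℂ V} (hf : ∀ x ∈ W, f x ∈ W) (c : ℂ) (n : ℕ)
    (w : W) : (((f.restrict hf - c • (1 : Module.End ℂ W)) ^ n) w : V) =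
      ((f - c • (1 : Module.End ℂ V)) ^ n) w := by
  induction n generalizing w with
  | zero => rfl
  | succ n ih =>
    rw [pow_succ, pow_succ, Module.End.mul_apply, Module.End.mul_apply, ih]
    rfl

theorem restrict_sub_smul_pow_eq_zero {f : Module.End ℂ V} (hf : ∀ x ∈ W, f x ∈ W) {c : ℂ} {n : ℕ}
    (h : ∀ w ∈ W, ((f - c • (1 : Module.End ℂ V)) ^ n) w = 0) :
    (f.restrict hf - c • (1 : Module.End ℂ W)) ^ n = 0 := by
  ext1 w
  apply Subtype.ext
  rw [coe_restrict_sub_smul_pow, h w w.2]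
  rfl

theorem commute_restrict {f g : Module.End ℂ V} (hf : ∀ x ∈ W, f x ∈ W) (hg : ∀ x ∈ W, g x ∈ W)
    (h : Commute f g) : Commute (f.restrict hf) (g.restrict hg) := by
  ext1 w
  apply Subtype.ext
  exact LinearMap.congr_fun h.eq w.1

theorem commute_sub_smul_pow {f g : Module.End ℂ V} (h : Commute f g) (c : ℂ) (n : ℕ) :
    Commute ((f - c • (1 : Module.End ℂ V)) ^ n) g :=
  (h.sub_left ((Commute.one_left g).smul_left c)).pow_left n

variable [FiniteDimensional ℂ W]

theorem exists_common_eigenvector_mem {ι : Type*} {τ : ι → Module.End ℂ V} {χ : ι → ℂ} {n : ℕ}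
    (hcomm : ∀ i j, Commute (τ i) (τ j)) (hW : ∀ i, ∀ w ∈ W, τ i w ∈ W)
    (hn : ∀ i, ∀ w ∈ W, ((τ i - χ i • (1 : Module.End ℂ V)) ^ n) w = 0) (hW0 : W ≠ ⊥) :
    ∃ e ∈ W, e ≠ 0 ∧ ∀ i, τ i e = χ i • e := by
  have : Nontrivial W := Submodule.nontrivial_iff_ne_bot.mpr hW0
  obtain ⟨e, he0, he⟩ := exists_common_eigenvector (T := fun i => (τ i).restrict (hW i)) (χ := χ)
    (fun i j => commute_restrict _ _ (hcomm i j))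
    (fun i => ⟨n, restrict_sub_smul_pow_eq_zero (hW i) (hn i)⟩)
  exact ⟨e, e.2, fun h => he0 (Subtype.ext h), fun i => congrArg Subtype.val (he i)⟩

/-- If each `τ y` has the single eigenvalue `m y` on `W`, then dividing by `m` makes the action on
`W` unipotent, and its matrix coefficients are polynomials in additive functions. -/
theorem exists_apply_eq_mul_polynomialFunctions [TopologicalSpace V] [IsTopologicalAddGroup V]
    [ContinuousSMul ℂ V] [T2Space V] {G : Type*} [AddCommGroup G] [TopologicalSpace G]
    {τ : G → Module.End ℂ V} (hτ : ∀ x y, τ (x + y) = τ x * τ y) (hW : ∀ y, ∀ w ∈ W, τ y w ∈ W)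
    {m : Exponential G} {n : ℕ}
    (hn : ∀ y, ∀ w ∈ W, ((τ y - m.1 y • (1 : Module.End ℂ V)) ^ (n + 1)) w = 0)
    (hcont : ∀ v, Continuous fun y => τ y v)
    (ℓ : V →ₗ[ℂ] ℂ) {w : V} (hw : w ∈ W) :
    ∃ p ∈ polynomialFunctions G, ∀ y, ℓ (τ y w) = p y * m.1 y := by
  have hm0 : ∀ y, m.1 y ≠ 0 := fun y h => by
    have h1 : m.1 (y + -y) = m.1 y * m.1 (-y) := AddChar.map_add_eq_mul _ _ _
    rw [h, zero_mul, add_neg_cancel, AddChar.map_zero_eq_one] at h1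
    exact one_ne_zero h1
  let T : G → Module.End ℂ W := fun y => (τ y).restrict (hW y)
  have hTadd : ∀ x y, T (x + y) = T x * T y := fun x y => by
    ext1 w
    apply Subtype.ext
    exact LinearMap.congr_fun (hτ x y) w.1
  let U : G → Module.End ℂ W := fun y => (m.1 y)⁻¹ • T y
  have hUadd : ∀ x y, U (x + y) = U x * U y := fun x y => by
    simp only [U]
    rw [smul_mul_smul_comm, hTadd, AddChar.map_add_eq_mul, mul_inv]
  have hUnil : ∀ y, (U y - 1) ^ (n + 1) = 0 := fun y => by
    have : U y - 1 = (m.1 y)⁻¹ • (T y - m.1 y • (1 : Module.End ℂ W)) := by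
      rw [smul_sub, smul_smul, inv_mul_cancel₀ (hm0 y), one_smul]
    rw [this, smul_pow, restrict_sub_smul_pow_eq_zero (hW y) (hn y), smul_zero]
  obtain ⟨p, hp, hpU⟩ := exists_polynomialFunctions_of_unipotent hUadd hUnil
    (fun ℓ w => by
      have h : (fun y => ℓ (U y w)) = fun y => (m.1 y)⁻¹ * ℓ ⟨τ y w, hW y w w.2⟩ :=
        funext fun y => by
          simp only [U]
          rw [LinearMap.smul_apply, map_smul, smul_eq_mul]
          rfl
      rw [h]
      exact (m.2.inv₀ hm0).mul ((LinearMap.continuous_of_finiteDimensional ℓ).comp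
        ((hcont w).subtype_mk _)))
    (ℓ ∘ₗ W.subtype) ⟨w, hw⟩
  refine ⟨p, hp, fun y => ?_⟩
  have h1 : p y = (m.1 y)⁻¹ * ℓ (τ y w) := by
    rw [← hpU]
    simp only [U]
    rw [LinearMap.smul_apply, map_smul, smul_eq_mul]
    rfl
  rw [h1, mul_comm, mul_inv_cancel_left₀ (hm0 y)]

/-- A finite dimensional space that is invariant under commuting operators is spanned by joint
generalized eigenvectors. -/
theorem le_span_generalized_eigenvectors {ι : Type*} {τ : ι → Module.End ℂ V}
    (hcomm : ∀ i j, Commute (τ i) (τ j)) (hW : ∀ i, ∀ w ∈ W, τ i w ∈ W) :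
    W ≤ Submodule.span ℂ {w | w ∈ W ∧ ∃ (χ : ι → ℂ) (n : ℕ),
      ∀ i, ((τ i - χ i • (1 : Module.End ℂ V)) ^ (n + 1)) w = 0} := by
  let T : ι → Module.End ℂ W := fun i => (τ i).restrict (hW i)
  have htop :=
    Module.End.iSup_iInf_maxGenEigenspace_eq_top_of_iSup_maxGenEigenspace_eq_top_of_commute
    T (fun i j _ => commute_restrict (hW i) (hW j) (hcomm i j))
    (fun i => Module.End.iSup_maxGenEigenspace_eq_top (T i))
  have key : ∀ χ : ι → ℂ, ⨅ i, (T i).maxGenEigenspace (χ i) ≤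
      (Submodule.span ℂ {w | w ∈ W ∧ ∃ (χ : ι → ℂ) (n : ℕ),
        ∀ i, ((τ i - χ i • (1 : Module.End ℂ V)) ^ (n + 1)) w = 0}).comap W.subtype := by
    intro χ w hw
    refine Submodule.subset_span ⟨w.2, χ, Module.finrank ℂ W, fun i => ?_⟩
    have h1 := (Submodule.mem_iInf _).mp hw i
    rw [Module.End.maxGenEigenspace_eq_genEigenspace_finrank, Module.End.mem_genEigenspace_nat,
      LinearMap.mem_ker] at h1
    rw [pow_succ', Module.End.mul_apply, Submodule.subtype_apply,
      ← coe_restrict_sub_smul_pow (hW i), h1]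
    exact map_zero _
  intro w hw
  have h := iSup_le key
  rw [htop] at h
  exact h (Submodule.mem_top (x := ⟨w, hw⟩))

end Invariant

/-! ### The action of the translations -/

variable {G : Type*} [AddCommGroup G] [TopologicalSpace G] [IsTopologicalAddGroup G]

theorem continuous_translate (f : C(G, ℂ)) : Continuous fun y => translate y f := by
  let F : C(G, C(G, ℂ)) := ContinuousMap.curry ⟨fun p : G × G => f (p.2 + p.1), by fun_prop⟩
  exact F.continuous

theorem translate_add (x y : G) : translate (x + y) = translate x * translate y := by
  ext f z
  rw [Module.End.mul_apply, translate_apply, translate_apply, translate_apply, add_assoc]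

theorem commute_translate (x y : G) : Commute (translate (G := G) x) (translate y) := by
  rw [Commute, SemiconjBy, ← translate_add, ← translate_add, add_comm]

/-- A common eigenfunction of all translations is a multiple of an exponential. -/
theorem exists_exponential_of_translate_eq_smul {f : C(G, ℂ)} (hf : f ≠ 0) {χ : G → ℂ}
    (h : ∀ y, translate y f = χ y • f) :
    ∃ m : Exponential G, (∀ y, m.1 y = χ y) ∧ ∃ c : ℂ, m.toContinuousMap = c • f := by
  have hval : ∀ x y, f (x + y) = χ y * f x := fun x y => by
    rw [← translate_apply, h]; rfl
  have hval0 : ∀ y, f y = χ y * f 0 := fun y => by simpa using hval 0 y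
  have h0 : f 0 ≠ 0 := fun h0 => hf (ContinuousMap.ext fun y => by rw [hval0, h0, mul_zero]; rfl)
  have hχ : ∀ y, χ y = (f 0)⁻¹ * f y := fun y => by
    rw [hval0 y]; field_simp
  have hcont : Continuous χ := by
    rw [funext hχ]; fun_prop
  refine ⟨⟨{ toFun := χ
             map_zero_eq_one' := by rw [hχ, inv_mul_cancel₀ h0]
             map_add_eq_mul' := fun x y => by rw [hχ (x + y), hval, hχ x]; ring }, hcont⟩,
    fun _ => rfl, (f 0)⁻¹, ContinuousMap.ext hχ⟩

end

section

/-! ### Exponential polynomials in finite dimensional varieties -/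

variable {G : Type*} [AddCommGroup G] [TopologicalSpace G] [IsTopologicalAddGroup G]

/-- A finite dimensional translation invariant space on which every translation has a single
eigenvalue consists of polynomial multiples of one exponential, which belongs to the space. -/
theorem exists_eq_polynomial_mul_exponential {E : Submodule ℂ C(G, ℂ)} [FiniteDimensional ℂ E]
    (hE : ∀ y, ∀ f ∈ E, translate y f ∈ E) {χ : G → ℂ} {k : ℕ}
    (hk : ∀ y, ∀ f ∈ E, ((translate y - χ y • (1 : Module.End ℂ C(G, ℂ))) ^ (k + 1)) f = 0)
    {f : C(G, ℂ)} (hf : f ∈ E) (hf0 : f ≠ 0) :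
    ∃ m : Exponential G, m.toContinuousMap ∈ E ∧
      ∃ p ∈ polynomialFunctions G, f = p * m.toContinuousMap := by
  obtain ⟨e, heE, he0, he⟩ := exists_common_eigenvector_mem commute_translate hE hk
    ((Submodule.ne_bot_iff _).mpr ⟨f, hf, hf0⟩)
  obtain ⟨m, hm, c, hc⟩ := exists_exponential_of_translate_eq_smul he0 he
  obtain rfl : χ = fun y => m.1 y := funext fun y => (hm y).symm
  refine ⟨m, by rw [hc]; exact E.smul_mem c heE, ?_⟩
  obtain ⟨p, hp, hpf⟩ := exists_apply_eq_mul_polynomialFunctions translate_add hE hk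
    continuous_translate
    (ContinuousMap.evalCLM ℂ (0 : G) : C(G, ℂ) →L[ℂ] ℂ).toLinearMap hf
  refine ⟨p, hp, ContinuousMap.ext fun y => (Eq.trans ?_ (hpf y))⟩
  change f y = f (0 + y)
  rw [zero_add]

/-- A joint generalized eigenvector of the translations in a finite dimensional translation
invariant space is a polynomial multiple of an exponential. -/
theorem exists_eq_polynomial_mul_exponential_of_generalized_eigenvector
    {W : Submodule ℂ C(G, ℂ)} [FiniteDimensional ℂ W] (hW : ∀ y, ∀ f ∈ W, translate y f ∈ W)
    {χ : G → ℂ} {n : ℕ} {f : C(G, ℂ)} (hfW : f ∈ W)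
    (hf : ∀ y, ((translate y - χ y • (1 : Module.End ℂ C(G, ℂ))) ^ (n + 1)) f = 0) (hf0 : f ≠ 0) :
    ∃ m : Exponential G, m.toContinuousMap ∈ W ∧
      ∃ p ∈ polynomialFunctions G, f = p * m.toContinuousMap := by
  let N : G → Module.End ℂ C(G, ℂ) := fun y => translate y - χ y • (1 : Module.End ℂ C(G, ℂ))
  let E : Submodule ℂ C(G, ℂ) := W ⊓ ⨅ y, LinearMap.ker (N y ^ (n + 1))
  have hmem : ∀ {f}, f ∈ E ↔ f ∈ W ∧ ∀ y, (N y ^ (n + 1)) f = 0 := fun {f} => by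
    rw [Submodule.mem_inf, Submodule.mem_iInf]
    rfl
  have hfin : FiniteDimensional ℂ E := Submodule.finiteDimensional_of_le (S₂ := W) inf_le_left
  have hinv : ∀ y, ∀ f ∈ E, translate y f ∈ E := by
    intro y f hf
    rw [hmem] at hf ⊢
    refine ⟨hW y f hf.1, fun x => ?_⟩
    rw [← Module.End.mul_apply, (commute_sub_smul_pow (commute_translate x y) (χ x) _).eq,
      Module.End.mul_apply, hf.2 x, map_zero]
  obtain ⟨m, hm, p, hp, hwp⟩ := exists_eq_polynomial_mul_exponential hinv
    (fun y f hf => (hmem.mp hf).2 y) (hmem.mpr ⟨hfW, hf⟩) hf0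
  exact ⟨m, (hmem.mp hm).1, p, hp, hwp⟩

/-- A finite dimensional translation invariant space is spanned by polynomial multiples of
exponentials that belong to it. -/
theorem le_span_polynomial_mul_exponential {W : Submodule ℂ C(G, ℂ)} [FiniteDimensional ℂ W]
    (hW : ∀ y, ∀ f ∈ W, translate y f ∈ W) :
    W ≤ Submodule.span ℂ {f | f ∈ W ∧ ∃ m : Exponential G, m.toContinuousMap ∈ W ∧
      ∃ p ∈ polynomialFunctions G, f = p * m.toContinuousMap} := by
  refine (le_span_generalized_eigenvectors commute_translate hW).trans
    (Submodule.span_le.mpr ?_)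
  rintro f ⟨hf, χ, n, hn⟩
  rcases eq_or_ne f 0 with rfl | hf0
  · exact Submodule.zero_mem _
  obtain ⟨m, hm, p, hp, hfp⟩ :=
    exists_eq_polynomial_mul_exponential_of_generalized_eigenvector hW hf hn hf0
  exact Submodule.subset_span ⟨hf, m, hm, p, hp, hfp⟩

/-- The polynomials in additive functions are stable under reflection. -/
theorem reflect_mem_polynomialFunctions {p : C(G, ℂ)} (hp : p ∈ polynomialFunctions G) :
    reflect p ∈ polynomialFunctions G := by
  refine Algebra.adjoin_induction (p := fun p _ => reflect p ∈ polynomialFunctions G)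
    ?_ ?_ ?_ ?_ hp
  · intro a ha
    refine Algebra.subset_adjoin fun x y => ?_
    rw [reflect_apply, neg_add, ha]
    rfl
  · exact fun c => (polynomialFunctions G).algebraMap_mem c
  · exact fun p q _ _ hp hq => add_mem hp hq
  · exact fun p q _ _ hp hq => mul_mem hp hq

variable [LocallyCompactSpace G] [T2Space G] [MeasurableSpace G] [BorelSpace G]

/-! ### Localizability and synthesis -/

open FourierAlgebra

/-- Localizability implies synthesis: the functionals `φ ↦ D φ m` of the polynomial derivations that
annihilate the ideal are functions whose translates span finite dimensional varieties. -/
theorem IsLocalizable.isSynthesizable {I : Ideal (FourierAlgebra G)} (h : IsLocalizable I) :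
    IsSynthesizable (annihilator {μ | transform μ ∈ I}) := by
  set V := annihilator {μ : compactMeasures G | transform μ ∈ I} with hV
  intro f hf
  set S := sSup {W : Submodule ℂ C(G, ℂ) | IsVariety W ∧ FiniteDimensional ℂ W ∧ W ≤ V}
  by_contra hcon
  obtain ⟨ℓ, hℓ0, hℓ⟩ := exists_eq_zero_of_notMem_isClosed (S := S.topologicalClosure)
    S.isClosed_topologicalClosure hcon
  obtain ⟨μ, hμ⟩ := exists_pairing_eq (ℓ.comp reflect)
  have hμ' : ∀ g, ℓ g = pairing μ.1 (reflect g) := fun g => by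
    rw [hμ, ContinuousLinearMap.comp_apply, reflect_reflect]
  refine hℓ ?_
  rw [hμ']
  refine mem_annihilator_iff.mp hf μ (h _ fun m _ D hD => ?_)
  obtain ⟨g, hg, F, hF, hgF⟩ := exists_translate_mem_finiteDimensional hD.1 m
  have hgV : g ∈ V := mem_annihilator_iff.mpr fun ν hν => by
    rw [← hg]; exact hD.2 _ hν
  rw [hg, ← hμ']
  refine hℓ0 g (S.le_topologicalClosure ?_)
  let W : Submodule ℂ C(G, ℂ) := Submodule.span ℂ (Set.range fun y => translate y g)
  have hWF : W ≤ F := Submodule.span_le.mpr (by rintro _ ⟨y, rfl⟩; exact hgF y)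
  have hWfin : FiniteDimensional ℂ W := Submodule.finiteDimensional_of_le hWF
  have hWV : W ≤ V := Submodule.span_le.mpr (by
    rintro _ ⟨y, rfl⟩
    exact (isVariety_annihilator _).translate_mem g hgV y)
  have hWinv : ∀ f ∈ W, ∀ y, translate y f ∈ W := by
    intro f hf y
    have : W ≤ W.comap (translate y) := Submodule.span_le.mpr (by
      rintro _ ⟨x, rfl⟩
      refine Submodule.subset_span ⟨y + x, ?_⟩
      simp only [translate_add]
      rfl)
    exact this hf
  have hgW : g ∈ W := Submodule.subset_span ⟨0, by ext x; simp [translate_apply]⟩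
  have hW : IsVariety W ∧ FiniteDimensional ℂ W ∧ W ≤ V :=
    ⟨⟨W.closed_of_finiteDimensional, hWinv⟩, hWfin, hWV⟩
  exact le_sSup (show W ∈ {W | IsVariety W ∧ FiniteDimensional ℂ W ∧ W ≤ V} from hW) hgW

/-- Synthesis implies localizability: a finite dimensional variety is spanned by products of
polynomials and exponentials, and these are the functionals of polynomial derivations. -/
theorem IsSynthesizable.isLocalizable {I : Ideal (FourierAlgebra G)}
    (hI : IsClosed (I : Set (FourierAlgebra G)))
    (h : IsSynthesizable (annihilator {μ | transform μ ∈ I})) : IsLocalizable I := by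
  intro φ hφ
  obtain ⟨μ, rfl⟩ := transform_surjective φ
  by_contra hμ
  let J : Submodule ℂ (compactMeasures G) := (I.restrictScalars ℂ).comap (transformLinear G)
  have hJ : ∀ ν, ν ∈ J ↔ transform ν ∈ I := fun _ => Iff.rfl
  obtain ⟨f, hf0, hfμ⟩ := exists_pairing_ne_zero (J := J)
    (hI.preimage continuous_transform) (μ := μ) hμ
  have hfV : reflect f ∈ annihilator {ν : compactMeasures G | transform ν ∈ I} :=
    mem_annihilator_iff.mpr fun ν hν => by rw [reflect_reflect]; exact hf0 ν hν
  let ℓ : C(G, ℂ) →L[ℂ] ℂ := (pairingCLM μ).comp reflect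
  have hℓ : ∀ g, ℓ g = pairing μ.1 (reflect g) := fun _ => rfl
  have hker : IsClosed (LinearMap.ker ℓ.toLinearMap : Set C(G, ℂ)) := ℓ.isClosed_ker
  suffices hS : sSup {W : Submodule ℂ C(G, ℂ) | IsVariety W ∧ FiniteDimensional ℂ W ∧
      W ≤ annihilator {ν : compactMeasures G | transform ν ∈ I}} ≤ LinearMap.ker ℓ.toLinearMap by
    have h1 : reflect f ∈ LinearMap.ker ℓ.toLinearMap := closure_minimal hS hker (h hfV)
    have h2 : pairing μ.1 (reflect (reflect f)) = 0 := h1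
    rw [reflect_reflect] at h2
    exact hfμ h2
  refine sSup_le ?_
  rintro W ⟨hWvar, hWfin, hWV⟩
  refine (le_span_polynomial_mul_exponential fun y f hf => hWvar.translate_mem f hf y).trans
    (Submodule.span_le.mpr ?_)
  rintro _ ⟨hgW, m, hm, p, hp, rfl⟩
  obtain ⟨D, hD, hDp⟩ := exists_polynomialDerivation (reflect_mem_polynomialFunctions hp)
  have hDeval : ∀ ν, (D (transform ν)).eval m =
      pairing ν.1 (reflect (p * m.toContinuousMap)) := fun ν => by
    rw [hDp, eval_transform, pairing_mulMeasure]
    rfl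
  change pairing μ.1 (reflect (p * m.toContinuousMap)) = 0
  rw [← hDeval]
  refine hφ m (fun ψ hψ => ?_) D ⟨hD, fun ψ hψ => ?_⟩
  · obtain ⟨ν, rfl⟩ := transform_surjective ψ
    exact mem_annihilator_iff.mp (hWV hm) ν hψ
  · obtain ⟨ν, rfl⟩ := transform_surjective ψ
    rw [hDeval]
    exact mem_annihilator_iff.mp (hWV hgW) ν hψ

end

end SpectralSynthesis

end

theorem mainTheorem1 {G : Type*} [AddCommGroup G] [TopologicalSpace G] [IsTopologicalAddGroup G]
    [LocallyCompactSpace G] [T2Space G] [MeasurableSpace G] [BorelSpace G]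
    (I : Ideal (SpectralSynthesis.FourierAlgebra G))
    (hI : IsClosed (I : Set (SpectralSynthesis.FourierAlgebra G))) :
    SpectralSynthesis.IsSynthesizable
        (SpectralSynthesis.annihilator {μ | SpectralSynthesis.transform μ ∈ I}) ↔
      SpectralSynthesis.IsLocalizable I :=
  ⟨SpectralSynthesis.IsSynthesizable.isLocalizable hI,
    SpectralSynthesis.IsLocalizable.isSynthesizable⟩
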